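/- Let $q(x;\mu,\Sigma)=(2\pi)^{-d/2}|\Sigma|^{-1/2}\exp\left(-\tfrac12 (x-\mu)^\top\Sigma^{-1}(x-\mu)\right)$ denote the density of $\mathcal N(\mu,\Sigma)$ on $\mathbb R^d$, where $|\Sigma|=\det\Sigma$. Let $$\pi(x)=\sum_{k=1}^M\alpha_k\,q(x;\mu_k,\Sigma_k),\qquad \sum_{k=1}^M\alpha_k=1,\qquad \alpha_k>0,$$ with positive definite covariance matrices $\Sigma_k$, let $0<\beta_1<\dots<\beta_n=1$, and let $\pi_i$ be the probability measure on $\mathbb R^d$ with density proportional to $\pi(x)^{\beta_i}$. For a probability measure $\nu$ on $\mathbb R^d$ and $C\ge 0$, say that $\nu$ satisfies a log-Sobolev inequality with constant $C$ if for all continuously differentiable $f$ with $f,\nabla f\in L^2(\nu)$ the entropy $\mathrm{Ent}_\nu(f^2)=\int f^2\log f^2\,d\nu-\int f^2\,d\nu\,\log\int f^2\,d\nu$ is finite and $$\mathrm{Ent}_\nu(f^2)\le 2C\int\|\nabla f\|^2\,d\nu ;$$ let $C_{\mathrm{LSI}}(\nu)$ be the infimum of all such $C$. Then the following hold. 1.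 (Density ratio bound) For $2\le i\le n$ and $\Delta\beta=\beta_i-\beta_{i-1}$, $\pi_i\ll\pi_{i-1}$ and, almost everywhere, $$\frac{d\pi_i}{d\pi_{i-1}}\le\frac{1}{\min_k\alpha_k}\left(\frac{\beta_i}{\beta_{i-1}}\right)^{d/2}\left(\frac{\max_k|\Sigma_k|}{\min_k|\Sigma_k|}\right)^{\Delta\beta/2}.$$ 2. (Local LSI constants) Let $$\tilde\nu_k^{(i)}(x)=\frac{\pi(x)^{\beta_i}}{\sum_{j=1}^M\alpha_j\,q(x;\mu_j,\Sigma_j)^{\beta_i}}\,q(x;\mu_k,\Sigma_k)^{\beta_i},\qquad w_k^{(i)}=\frac{\alpha_k\int\tilde\nu_k^{(i)}(x)\,dx}{\sum_{j=1}^M\alpha_j\int\tilde\nu_j^{(i)}(x)\,dx},$$ and let $\nu_k^{(i)}$ be the probability measure with density proportional to $\tilde\nu_k^{(i)}$. Then $w_k^{(i)}>0$, $\sum_k w_k^{(i)}=1$ and $\pi_i=\sum_{k=1}^M w_k^{(i)}\nu_k^{(i)}$ for every $i$, and every $\nu_k^{(i)}$ satisfies a log-Sobolev inequality with constant $\frac{1}{\min_j\alpha_j}\cdot\frac{\lambda_{\max}(\Sigma_k)}{\beta_i}$,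 so that $$C_{\mathrm{LSI}}(\nu_k^{(i)})\le\frac{1}{\min_j\alpha_j}\cdot\frac{\lambda_{\max}(\Sigma_k)}{\beta_i}.$$ 3. (Weight lower bound) $$\min_{i,k}w_k^{(i)}\ \ge\ \min_{i,k}\frac{\int q(x;\mu_k,\Sigma_k)^{\beta_i}\,dx}{\sum_j\alpha_j\int q(x;\mu_j,\Sigma_j)^{\beta_i}\,dx}\cdot\min_k\alpha_k^2 ,$$ and if $\Sigma_j=\Sigma_k$ for all $j,k$, then $\min_{i,k}w_k^{(i)}\ge\min_k\alpha_k^2$. -/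

import Mathlib

open MeasureTheory
open scoped ENNReal NNReal

namespace TemperedMixture

noncomputable section

/-- The density `q(x; m, S)` of the Gaussian law `N(m, S)` on `ℝ^d`, for a positive definite
covariance matrix `S`. -/
def gaussianDensity {d : ℕ} (m : EuclideanSpace ℝ (Fin d)) (S : Matrix (Fin d) (Fin d) ℝ)
    (x : EuclideanSpace ℝ (Fin d)) : ℝ :=
  ((2 * Real.pi) ^ ((d : ℝ) / 2) * Real.sqrt S.det)⁻¹ *
    Real.exp (-(1 / 2) * ((x - m).ofLp ⬝ᵥ (S⁻¹).mulVec (x - m).ofLp))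

/-- The Gaussian mixture density `π(x) = ∑ k, α k * q(x; m k, S k)`. -/
def mixtureDensity {d M : ℕ} (α : Fin M → ℝ) (m : Fin M → EuclideanSpace ℝ (Fin d))
    (S : Fin M → Matrix (Fin d) (Fin d) ℝ) (x : EuclideanSpace ℝ (Fin d)) : ℝ :=
  ∑ k, α k * gaussianDensity (m k) (S k) x

/-- The probability measure on `ℝ^d` with Lebesgue density proportional to the nonnegative
function `f` (meaningful when `0 < ∫ f < ∞`). -/
def measureProportionalTo {d : ℕ} (f : EuclideanSpace ℝ (Fin d) → ℝ) :
    Measure (EuclideanSpace ℝ (Fin d)) :=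
  (∫⁻ x, ENNReal.ofReal (f x))⁻¹ • volume.withDensity (fun x => ENNReal.ofReal (f x))

/-- The power-tempered measure with density proportional to `π(x) ^ b`. -/
def temperedMeasure {d M : ℕ} (α : Fin M → ℝ) (m : Fin M → EuclideanSpace ℝ (Fin d))
    (S : Fin M → Matrix (Fin d) (Fin d) ℝ) (b : ℝ) : Measure (EuclideanSpace ℝ (Fin d)) :=
  measureProportionalTo (fun x => mixtureDensity α m S x ^ b)

/-- The unnormalized component
`π(x) ^ b / (∑ j, α j * q(x; m j, S j) ^ b) * q(x; m k, S k) ^ b`. -/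
def componentDensity {d M : ℕ} (α : Fin M → ℝ) (m : Fin M → EuclideanSpace ℝ (Fin d))
    (S : Fin M → Matrix (Fin d) (Fin d) ℝ) (b : ℝ) (k : Fin M)
    (x : EuclideanSpace ℝ (Fin d)) : ℝ :=
  mixtureDensity α m S x ^ b / (∑ j, α j * gaussianDensity (m j) (S j) x ^ b) *
    gaussianDensity (m k) (S k) x ^ b

/-- The component `ν_k`, the probability measure with density proportional to
`componentDensity`. -/
def componentMeasure {d M : ℕ} (α : Fin M → ℝ) (m : Fin M → EuclideanSpace ℝ (Fin d))
    (S : Fin M → Matrix (Fin d) (Fin d) ℝ) (b : ℝ) (k : Fin M) :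
    Measure (EuclideanSpace ℝ (Fin d)) :=
  measureProportionalTo (componentDensity α m S b k)

/-- The normalized mixture weight
`w_k = α k * ∫ componentDensity k / ∑ j, α j * ∫ componentDensity j`. -/
def componentWeight {d M : ℕ} (α : Fin M → ℝ) (m : Fin M → EuclideanSpace ℝ (Fin d))
    (S : Fin M → Matrix (Fin d) (Fin d) ℝ) (b : ℝ) (k : Fin M) : ℝ :=
  (α k * ∫ x, componentDensity α m S b k x) / ∑ j, α j * ∫ x, componentDensity α m S b j x

/-- The entropy `∫ g log g dν - (∫ g dν) log (∫ g dν)` of a nonnegative function `g`. -/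
def entropy {d : ℕ} (ν : Measure (EuclideanSpace ℝ (Fin d)))
    (g : EuclideanSpace ℝ (Fin d) → ℝ) : ℝ :=
  (∫ x, g x * Real.log (g x) ∂ν) - (∫ x, g x ∂ν) * Real.log (∫ x, g x ∂ν)

/-- The logarithmic Sobolev inequality `Ent_ν(f²) ≤ 2 C ∫ ‖∇f‖² dν` with constant `C`, for all
continuously differentiable `f` with `f` and `∇f` in `L²(ν)`. The finiteness of the entropy is
part of the assertion. The integral `∫ ‖∇f‖² dν` is the Dirichlet form of the Langevin diffusion
with stationary measure `ν`. -/
def SatisfiesLSI {d : ℕ} (ν : Measure (EuclideanSpace ℝ (Fin d))) (C : ℝ≥0) : Prop :=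
  ∀ f : EuclideanSpace ℝ (Fin d) → ℝ, ContDiff ℝ 1 f → MemLp f 2 ν → MemLp (gradient f) 2 ν →
    Integrable (fun x => f x ^ 2 * Real.log (f x ^ 2)) ν ∧
      entropy ν (fun x => f x ^ 2) ≤ 2 * (C : ℝ) * ∫ x, ‖gradient f x‖ ^ 2 ∂ν

/-- The log-Sobolev constant: the infimum of all admissible constants (`∞` if there is none). -/
def logSobolevConstant {d : ℕ} (ν : Measure (EuclideanSpace ℝ (Fin d))) : ℝ≥0∞ :=
  ⨅ (C : ℝ≥0) (_ : SatisfiesLSI ν C), (C : ℝ≥0∞)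

end

end TemperedMixture

open TemperedMixture

namespace TemperedMixture

open Filter Topology Set ProbabilityTheory

/-! ### The logarithmic Sobolev inequality on the real line -/

/-! Write `q_k` for the components, `π` for the mixture and `p_b = ∑ α_j q_j ^ b`. Everything rests
on the comparison `p_b ≤ π ^ b ≤ p_b / min α` for `0 < b ≤ 1`. The left side is Jensen for the
concave function `t ^ b` (`powMixture_le_mixtureDensity_rpow`); the right side holds because `π` is
at most its largest component (`mixtureDensity_rpow_le_powMixture`). Moreover `q_k ^ b` is a
multiple of the Gaussian density with covariance `S_k / b`, so its integral is explicit.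

Density ratio: `dπ_c / dπ_b` is `π ^ (c - b)` times `∫ π ^ b / ∫ π ^ c`. The first factor is at most
a power of the peak value of the components; the second is controlled by passing from `π` to `p_b`,
comparing the Gaussian integrals at `b` and `c`, and returning to `π` by Jensen. The powers of `2π`
cancel.

Weights and components: the unnormalized component is `q_k ^ b` times the factor `π ^ b / p_b`,
which lies in `[1, 1 / min α]`. This bounds the weights. It also exhibits each component measure as
a bounded perturbation of a Gaussian law, so the Holley–Stroock principle
(`TameLSIWith.withDensity`) costs only a factor `1 / min α` over the Gaussian constant `λ_max / b`.

The Gaussian inequality itself comes from monotone transport on intervals of the line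
(`integral_mul_log_le_of_integral_eq`), a limit to the whole line, tensorization (`TameLSI.prod`)
and affine images (`TameLSI.map_add_clm`). These steps use tame test functions, for which
integrability and differentiation under the integral are automatic. Cutoffs and Fatou's lemma
(`TameLSIWith.satisfiesLSI`) then reach all admissible `f` and also give finiteness of the entropy.
-/

theorem hasDerivAt_integral_of_continuous {f : ℝ → ℝ} (hf : Continuous f) (a x : ℝ) :
    HasDerivAt (fun u => ∫ t in a..u, f t) (f x) x :=
  intervalIntegral.integral_hasDerivAt_right (hf.intervalIntegrable _ _)
    hf.aestronglyMeasurable.stronglyMeasurableAtFilter hf.continuousAt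

/-- The monotone transport map between two positive densities on an interval. -/
theorem exists_monotone_transport {p w : ℝ → ℝ} {a b c : ℝ} (hp : Continuous p)
    (hp_pos : ∀ x, 0 < p x) (hw : Continuous w) (hc : 0 < c) (hw_ge : ∀ x, c ≤ w x)
    (heq : ∫ t in a..b, p t = ∫ t in a..b, w t) :
    ∃ T : ℝ → ℝ, (∀ x, HasDerivAt T (p x / w (T x)) x) ∧ StrictMono T ∧ T a = a ∧ T b = b := by
  set W : ℝ → ℝ := fun u => ∫ t in a..u, w t with hW
  have hW' : ∀ x, HasDerivAt W (w x) x := hasDerivAt_integral_of_continuous hw a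
  have hw_pos : ∀ x, 0 < w x := fun x => hc.trans_le (hw_ge x)
  have hWmono : StrictMono W := strictMono_of_hasDerivAt_pos hW' hw_pos
  have hWcont : Continuous W := continuous_iff_continuousAt.2 fun x => (hW' x).continuousAt
  -- Growth at rate at least `c` makes `W` a bijection of the line, so the transport can be taken as
  -- the inverse of `W` composed with the primitive of `p`.
  have hlin : Monotone fun x => W x - c * x := by
    refine monotone_of_hasDerivAt_nonneg (f' := fun x => w x - c) (fun x => ?_) fun x => ?_
    · exact ((hW' x).sub ((hasDerivAt_id x).const_mul c)).congr_deriv (by simp)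
    · simpa using hw_ge x
  have hWa : W a = 0 := by simp [hW]
  have htop : Tendsto W atTop atTop := by
    refine tendsto_atTop_mono' atTop (f₁ := fun x => c * x - c * a) ?_ ?_
    · filter_upwards [eventually_ge_atTop a] with x hx
      have := hlin hx
      simp only [hWa] at this
      linarith
    · exact tendsto_atTop_add_const_right _ _ (tendsto_id.const_mul_atTop hc)
  have hbot : Tendsto W atBot atBot := by
    refine tendsto_atBot_mono' atBot (f₁ := fun x => c * x - c * a) ?_ ?_
    · filter_upwards [eventually_le_atBot a] with x hx
      have := hlin hx
      simp only [hWa] at this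
      linarith
    · exact tendsto_atBot_add_const_right _ _ (tendsto_id.const_mul_atBot hc)
  let e : ℝ ≃o ℝ := hWmono.orderIsoOfSurjective W (hWcont.surjective htop hbot)
  have heW : ∀ x, e x = W x := fun _ => rfl
  have hWe : ∀ y, W (e.symm y) = y := fun y => e.apply_symm_apply y
  have hP' : ∀ x, HasDerivAt (fun u => ∫ t in a..u, p t) (p x) x :=
    hasDerivAt_integral_of_continuous hp a
  have hT' : ∀ x, HasDerivAt (fun x => e.symm (∫ t in a..x, p t))
      (p x / w (e.symm (∫ t in a..x, p t))) x := by
    intro x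
    have h := HasDerivAt.of_local_left_inverse (f := W) (g := e.symm) (a := ∫ t in a..x, p t)
      e.symm.continuous.continuousAt (hW' _) (hw_pos _).ne' (Eventually.of_forall hWe)
    have := h.comp x (hP' x)
    rw [div_eq_inv_mul]
    exact this
  refine ⟨_, hT', strictMono_of_hasDerivAt_pos hT' fun x => div_pos (hp_pos x) (hw_pos _), ?_, ?_⟩
  · rw [e.symm_apply_eq, heW, hWa, intervalIntegral.integral_same]
  · rw [e.symm_apply_eq, heW, heq]

theorem hasDerivAt_exp_neg_sq_half (x : ℝ) :
    HasDerivAt (fun x : ℝ => Real.exp (-x ^ 2 / 2)) (-x * Real.exp (-x ^ 2 / 2)) x := by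
  have h : HasDerivAt (fun x : ℝ => -x ^ 2 / 2) (-x) x := by
    exact ((hasDerivAt_pow 2 x).neg.div_const 2).congr_deriv (by push_cast; ring)
  exact h.exp.congr_deriv (by ring)

/-- The normalized logarithmic Sobolev inequality for the Gaussian weight on an interval. -/
theorem integral_mul_log_le_of_integral_eq {g g' : ℝ → ℝ} {R : ℝ} (hR : 0 < R)
    (hg : ∀ x, HasDerivAt g (g' x) x) (hg' : Continuous g') (hg_pos : ∀ x, 0 < g x)
    (heq : ∫ t in (-R)..R, g t * Real.exp (-t ^ 2 / 2) = ∫ t in (-R)..R, Real.exp (-t ^ 2 / 2)) :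
    ∫ t in (-R)..R, (g t * Real.log (g t) - g' t ^ 2 / (2 * g t)) * Real.exp (-t ^ 2 / 2) ≤ 0 := by
  have hgc : Continuous g := continuous_iff_continuousAt.2 fun x => (hg x).continuousAt
  -- The Gaussian weight is frozen outside `[-R, R]`: it is then bounded below on the whole line, so
  -- the transport map is globally defined and differentiable.
  set w : ℝ → ℝ := fun x => Real.exp (-(max (-R) (min x R)) ^ 2 / 2) with hw
  have hwc : Continuous w := by fun_prop
  have hw_eq : ∀ x ∈ Icc (-R) R, w x = Real.exp (-x ^ 2 / 2) := by
    intro x hx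
    simp only [hw, min_eq_left hx.2, max_eq_right hx.1]
  have hw_ge : ∀ x, Real.exp (-R ^ 2 / 2) ≤ w x := by
    intro x
    apply Real.exp_le_exp.2
    have h1 : -R ≤ max (-R) (min x R) := le_max_left _ _
    have h2 : max (-R) (min x R) ≤ R := max_le (by linarith) (min_le_right _ _)
    nlinarith
  have hle : -R ≤ R := by linarith
  obtain ⟨T, hT', hTmono, hTa, hTb⟩ := exists_monotone_transport (p := fun x => g x * w x) (w := w)
    (a := -R) (b := R) (hgc.mul hwc) (fun x => mul_pos (hg_pos x) (Real.exp_pos _)) hwc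
    (Real.exp_pos _) hw_ge (by
      rw [intervalIntegral.integral_congr (g := fun t => g t * Real.exp (-t ^ 2 / 2)),
        intervalIntegral.integral_congr (f := w) (g := fun t => Real.exp (-t ^ 2 / 2)), heq]
      · intro x hx
        rw [uIcc_of_le hle] at hx
        exact hw_eq x hx
      · intro x hx
        rw [uIcc_of_le hle] at hx
        simp only [hw_eq x hx])
  -- The integrand will be dominated pointwise by the derivative of `g (T - id) exp(-x²/2)`, which
  -- vanishes at `±R` because `T` fixes the endpoints.
  have hH' : ∀ x, HasDerivAt (fun x => g x * (T x - x) * Real.exp (-x ^ 2 / 2))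
      ((g' x * (T x - x) + g x * (g x * w x / w (T x) - 1)) * Real.exp (-x ^ 2 / 2) +
        g x * (T x - x) * (-x * Real.exp (-x ^ 2 / 2))) x := fun x =>
    ((hg x).mul ((hT' x).sub (hasDerivAt_id x))).mul (hasDerivAt_exp_neg_sq_half x)
  have hφc : Continuous fun t => (g t * Real.log (g t) - g' t ^ 2 / (2 * g t)) *
      Real.exp (-t ^ 2 / 2) := by
    have h1 : Continuous fun t => Real.log (g t) := hgc.log fun x => (hg_pos x).ne'
    have h2 : Continuous fun t => g' t ^ 2 / (2 * g t) :=
      (hg'.pow 2).div (continuous_const.mul hgc) fun x => by have := hg_pos x; positivity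
    fun_prop
  refine (intervalIntegral.integral_le_sub_of_hasDeriv_right_of_le hle
    (g := fun x => g x * (T x - x) * Real.exp (-x ^ 2 / 2))
    (fun x _ => (hH' x).continuousAt.continuousWithinAt)
    (fun x _ => (hH' x).hasDerivWithinAt) hφc.continuousOn.integrableOn_Icc ?_).trans_eq ?_
  · intro x hx
    have hTx : T x ∈ Icc (-R) R :=
      ⟨hTa ▸ hTmono.monotone hx.1.le, hTb ▸ hTmono.monotone hx.2.le⟩
    rw [hw_eq x (Ioo_subset_Icc_self hx), hw_eq _ hTx]
    set y := T x
    have hgx := hg_pos x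
    -- `q` is `T' x`; the next identity is the logarithm of the change of variables equation for
    -- `T`.
    set q := g x * Real.exp (-x ^ 2 / 2) / Real.exp (-y ^ 2 / 2) with hq
    have hq_pos : 0 < q := by positivity
    have hlog : Real.log (g x) = Real.log q + (x ^ 2 - y ^ 2) / 2 := by
      rw [hq, Real.log_div (by positivity) (by positivity), Real.log_mul hgx.ne' (by positivity),
        Real.log_exp, Real.log_exp]
      ring
    have hlq := Real.log_le_sub_one_of_pos hq_pos
    -- Completing the square. The term `g (y - x)² / 2` combines with `g (x² - y²) / 2` from the
    -- logarithm to give exactly `-g (y - x) x`.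
    have hsq : -(g' x ^ 2 / (2 * g x)) ≤ g' x * (y - x) + g x * (y - x) ^ 2 / 2 := by
      rw [neg_le_iff_add_nonneg]
      have : g' x * (y - x) + g x * (y - x) ^ 2 / 2 + g' x ^ 2 / (2 * g x) =
          (g' x + g x * (y - x)) ^ 2 / (2 * g x) := by
        field_simp
        ring
      rw [this]
      positivity
    have hmain : g x * Real.log (g x) - g' x ^ 2 / (2 * g x) ≤
        g' x * (y - x) + g x * (q - 1) - g x * (y - x) * x := by
      have := mul_le_mul_of_nonneg_left hlq hgx.le
      rw [hlog]
      nlinarith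
    have := mul_le_mul_of_nonneg_right hmain (Real.exp_pos (-x ^ 2 / 2)).le
    linarith
  · simp [hTa, hTb]

/-- The logarithmic Sobolev inequality for the Gaussian weight on an interval. -/
theorem integral_mul_log_sub_le {u u' : ℝ → ℝ} {R : ℝ} (hR : 0 < R)
    (hu : ∀ x, HasDerivAt u (u' x) x) (hu' : Continuous u') (hu_pos : ∀ x, 0 < u x) :
    (∫ t in (-R)..R, u t * Real.log (u t) * Real.exp (-t ^ 2 / 2)) -
        (∫ t in (-R)..R, u t * Real.exp (-t ^ 2 / 2)) *
          Real.log ((∫ t in (-R)..R, u t * Real.exp (-t ^ 2 / 2)) /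
            ∫ t in (-R)..R, Real.exp (-t ^ 2 / 2)) ≤
      ∫ t in (-R)..R, u' t ^ 2 / (2 * u t) * Real.exp (-t ^ 2 / 2) := by
  have huc : Continuous u := continuous_iff_continuousAt.2 fun x => (hu x).continuousAt
  have hle : -R < R := by linarith
  set A := ∫ t in (-R)..R, u t * Real.exp (-t ^ 2 / 2) with hA
  set Z := ∫ t in (-R)..R, Real.exp (-t ^ 2 / 2) with hZ
  have hφ : Continuous fun t : ℝ => Real.exp (-t ^ 2 / 2) := by fun_prop
  have hA_pos : 0 < A := intervalIntegral.intervalIntegral_pos_of_pos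
    ((huc.mul hφ).intervalIntegrable _ _) (fun x => mul_pos (hu_pos x) (Real.exp_pos _)) hle
  have hZ_pos : 0 < Z := intervalIntegral.intervalIntegral_pos_of_pos
    (hφ.intervalIntegrable _ _) (fun x => Real.exp_pos _) hle
  -- Division by the mean `s` reduces to the normalized case; both sides are homogeneous of degree
  -- one in `u`.
  set s := A / Z with hs
  have hs_pos : 0 < s := div_pos hA_pos hZ_pos
  have key := integral_mul_log_le_of_integral_eq (g := fun x => u x / s) (g' := fun x => u' x / s)
    hR (fun x => (hu x).div_const s) (hu'.div_const s) (fun x => div_pos (hu_pos x) hs_pos) (by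
      simp_rw [div_mul_eq_mul_div]
      rw [intervalIntegral.integral_div, ← hA, ← hZ, hs, div_div_cancel₀ hA_pos.ne'])
  have hint : ∀ t, (u t / s * Real.log (u t / s) - (u' t / s) ^ 2 / (2 * (u t / s))) *
      Real.exp (-t ^ 2 / 2) = (u t * Real.log (u t) * Real.exp (-t ^ 2 / 2) -
        Real.log s * (u t * Real.exp (-t ^ 2 / 2)) -
        u' t ^ 2 / (2 * u t) * Real.exp (-t ^ 2 / 2)) / s := by
    intro t
    have := hu_pos t
    rw [Real.log_div this.ne' hs_pos.ne']
    field_simp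
  simp_rw [hint] at key
  have hc1 : Continuous fun t => u t * Real.log (u t) * Real.exp (-t ^ 2 / 2) :=
    (huc.mul (huc.log fun x => (hu_pos x).ne')).mul hφ
  have hc2 : Continuous fun t => Real.log s * (u t * Real.exp (-t ^ 2 / 2)) :=
    continuous_const.mul (huc.mul hφ)
  have hc3 : Continuous fun t => u' t ^ 2 / (2 * u t) * Real.exp (-t ^ 2 / 2) :=
    ((hu'.pow 2).div (continuous_const.mul huc) fun x => mul_ne_zero two_ne_zero (hu_pos x).ne').mul hφ
  rw [intervalIntegral.integral_div, intervalIntegral.integral_sub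
    (Continuous.intervalIntegrable (by fun_prop) _ _) (hc3.intervalIntegrable _ _),
    intervalIntegral.integral_sub (hc1.intervalIntegrable _ _) (hc2.intervalIntegrable _ _),
    intervalIntegral.integral_const_mul, ← hA, div_le_iff₀ hs_pos, zero_mul] at key
  linarith

/-! ### The logarithmic Sobolev inequality for tame functions -/

section Tame

variable {E F : Type*} [NormedAddCommGroup E] [NormedSpace ℝ E] [NormedAddCommGroup F]
  [NormedSpace ℝ F]

/-- A continuously differentiable function that is bounded, bounded away from zero, and has a
bounded derivative. -/
structure IsTame (u : E → ℝ) : Prop where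
  contDiff : ContDiff ℝ 1 u
  exists_pos_le : ∃ c, 0 < c ∧ ∀ x, c ≤ u x
  exists_le : ∃ K, ∀ x, u x ≤ K
  exists_norm_fderiv_le : ∃ K, ∀ x, ‖fderiv ℝ u x‖ ≤ K

namespace IsTame

variable {u : E → ℝ}

theorem pos (hu : IsTame u) (x : E) : 0 < u x := by
  obtain ⟨c, hc, h⟩ := hu.exists_pos_le
  exact hc.trans_le (h x)

theorem continuous (hu : IsTame u) : Continuous u := hu.contDiff.continuous

theorem hasFDerivAt (hu : IsTame u) (x : E) : HasFDerivAt u (fderiv ℝ u x) x :=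
  (hu.contDiff.differentiable one_ne_zero x).hasFDerivAt

theorem continuous_fderiv (hu : IsTame u) : Continuous (fderiv ℝ u) :=
  hu.contDiff.continuous_fderiv one_ne_zero

theorem fderiv_comp_add_clm (hu : IsTame u) (a : E) (A : F →L[ℝ] E) (y : F) :
    fderiv ℝ (fun y => u (a + A y)) y = (fderiv ℝ u (a + A y)).comp A :=
  ((hu.hasFDerivAt (a + A y)).comp y (A.hasFDerivAt.const_add a)).fderiv

theorem comp_add_clm (hu : IsTame u) (a : E) (A : F →L[ℝ] E) : IsTame fun y => u (a + A y) := by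
  obtain ⟨c, hc, h⟩ := hu.exists_pos_le
  obtain ⟨K, hK⟩ := hu.exists_le
  obtain ⟨K', hK'⟩ := hu.exists_norm_fderiv_le
  refine ⟨hu.contDiff.comp (contDiff_const.add A.contDiff), ⟨c, hc, fun y => h _⟩,
    ⟨K, fun y => hK _⟩, ⟨K' * ‖A‖, fun y => ?_⟩⟩
  rw [hu.fderiv_comp_add_clm]
  exact (ContinuousLinearMap.opNorm_comp_le _ _).trans (by gcongr; exact hK' _)

theorem continuous_fderiv_apply_sq_div (hu : IsTame u) (v : E) :
    Continuous (fun x => fderiv ℝ u x v ^ 2 / u x) :=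
  ((hu.continuous_fderiv.clm_apply continuous_const).pow 2).div hu.continuous
    fun x => (hu.pos x).ne'

theorem continuous_mul_log (hu : IsTame u) : Continuous fun x => u x * Real.log (u x) :=
  Real.continuous_mul_log.comp hu.continuous

variable [MeasurableSpace E] [BorelSpace E] {μ : Measure E}
  [IsFiniteMeasure μ]

theorem integrable (hu : IsTame u) : Integrable u μ := by
  obtain ⟨K, hK⟩ := hu.exists_le
  refine .of_bound hu.continuous.aestronglyMeasurable K (.of_forall fun x => ?_)
  rw [Real.norm_of_nonneg (hu.pos x).le]
  exact hK x

theorem integrable_mul_log (hu : IsTame u) : Integrable (fun x => u x * Real.log (u x)) μ := by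
  obtain ⟨c, hc, h⟩ := hu.exists_pos_le
  obtain ⟨K, hK⟩ := hu.exists_le
  obtain ⟨C, hC⟩ := (isCompact_Icc (a := c) (b := K)).exists_bound_of_continuousOn
    (Real.continuous_mul_log.continuousOn)
  exact .of_bound hu.continuous_mul_log.aestronglyMeasurable C
    (.of_forall fun x => hC (u x) ⟨h x, hK x⟩)

theorem integrable_fderiv_apply_sq_div (hu : IsTame u) (v : E) :
    Integrable (fun x => fderiv ℝ u x v ^ 2 / u x) μ := by
  obtain ⟨c, hc, h⟩ := hu.exists_pos_le
  obtain ⟨K, hK⟩ := hu.exists_norm_fderiv_le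
  refine .of_bound (hu.continuous_fderiv_apply_sq_div v).aestronglyMeasurable
    ((K * ‖v‖) ^ 2 / c) (.of_forall fun x => ?_)
  have hx := hu.pos x
  rw [Real.norm_of_nonneg (by positivity), ← sq_abs, ← Real.norm_eq_abs]
  gcongr
  · exact ((fderiv ℝ u x).le_opNorm v).trans (by gcongr; exact hK x)
  · exact h x

theorem integrable_sum_fderiv_apply_sq_div {ι : Type*} [Fintype ι] (hu : IsTame u) (v : ι → E) :
    Integrable (fun x => (∑ i, fderiv ℝ u x (v i) ^ 2) / u x) μ := by
  simp_rw [Finset.sum_div]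
  exact integrable_finsetSum _ fun i _ => hu.integrable_fderiv_apply_sq_div (v i)

end IsTame

/-- The logarithmic Sobolev inequality
`∫ u log u dμ - (∫ u dμ) log (∫ u dμ) ≤ (1/2) ∫ (∑ i, (∂_{v i} u)²) / u dμ` for tame `u`. -/
def TameLSI [MeasurableSpace E] {ι : Type*} [Fintype ι] (μ : Measure E) (v : ι → E) : Prop :=
  ∀ u : E → ℝ, IsTame u →
    ∫ x, u x * Real.log (u x) ∂μ - (∫ x, u x ∂μ) * Real.log (∫ x, u x ∂μ) ≤
      1 / 2 * ∫ x, (∑ i, fderiv ℝ u x (v i) ^ 2) / u x ∂μ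

/-- Integrate `(a - t u)² / u ≥ 0` with the optimal `t = ∫ a / ∫ u`. This is Cauchy–Schwarz, needed
to differentiate a marginal without loss in the Fisher information. -/
theorem sq_integral_div_le_integral_sq_div {α : Type*} [MeasurableSpace α] {μ : Measure α}
    {a u : α → ℝ} (hu_pos : ∀ x, 0 < u x) (hu : Integrable u μ) (ha : Integrable a μ)
    (hau : Integrable (fun x => a x ^ 2 / u x) μ) (hI : 0 < ∫ x, u x ∂μ) :
    (∫ x, a x ∂μ) ^ 2 / (∫ x, u x ∂μ) ≤ ∫ x, a x ^ 2 / u x ∂μ := by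
  set t := (∫ x, a x ∂μ) / ∫ x, u x ∂μ with ht
  have h : ∀ x, a x ^ 2 / u x - 2 * t * a x + t ^ 2 * u x = (a x - t * u x) ^ 2 / u x := by
    intro x
    have := (hu_pos x).ne'
    field_simp
    ring
  have h0 : 0 ≤ ∫ x, (a x ^ 2 / u x - 2 * t * a x + t ^ 2 * u x) ∂μ := by
    refine integral_nonneg fun x => ?_
    have := hu_pos x
    simp only [h, Pi.zero_apply]
    positivity
  rw [integral_add (by fun_prop) (by fun_prop), integral_sub hau (by fun_prop), integral_const_mul,
    integral_const_mul] at h0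
  have h1 : (∫ x, a x ∂μ) ^ 2 / (∫ x, u x ∂μ) = 2 * t * (∫ x, a x ∂μ) - t ^ 2 * ∫ x, u x ∂μ := by
    rw [ht]
    field_simp
    ring
  linarith

/-- Tame functions are stable under affine substitution, and by the chain rule the directions are
carried along by the linear part. Covariances enter the inequality in this way. -/
theorem TameLSI.map_add_clm [MeasurableSpace E] [BorelSpace E] [MeasurableSpace F] [BorelSpace F]
    {ι : Type*} [Fintype ι] {μ : Measure E} [IsProbabilityMeasure μ]
    {v : ι → E} (hμ : TameLSI μ v) (a : F) (A : E →L[ℝ] F) :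
    TameLSI (μ.map fun x => a + A x) fun i => A (v i) := by
  intro u hu
  have hA : AEMeasurable (fun x => a + A x) μ := by fun_prop
  have h := hμ _ (hu.comp_add_clm a A)
  simp only [hu.fderiv_comp_add_clm, ContinuousLinearMap.comp_apply] at h
  rw [integral_map hA hu.continuous.aestronglyMeasurable,
    integral_map hA hu.continuous_mul_log.aestronglyMeasurable,
    integral_map hA]
  · exact h
  · simp_rw [Finset.sum_div]
    exact (continuous_finsetSum _ fun i _ =>
      hu.continuous_fderiv_apply_sq_div _).aestronglyMeasurable

/-! ### Marginals of tame functions and tensorization -/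

section Product

variable {u : E × F → ℝ}

theorem IsTame.slice_right (hu : IsTame u) (x : E) : IsTame fun y => u (x, y) := by
  simpa using hu.comp_add_clm (x, 0) (ContinuousLinearMap.inr ℝ E F)

theorem IsTame.fderiv_slice_right (hu : IsTame u) (x : E) (y : F) :
    fderiv ℝ (fun y => u (x, y)) y =
      (fderiv ℝ u (x, y)).comp (ContinuousLinearMap.inr ℝ E F) := by
  simpa using hu.fderiv_comp_add_clm (x, 0) (ContinuousLinearMap.inr ℝ E F) y

variable [MeasurableSpace F] [BorelSpace F] [SecondCountableTopology F]

theorem IsTame.hasFDerivAt_integral_right (hu : IsTame u) (ν : Measure F) [IsProbabilityMeasure ν]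
    (x : E) :
    HasFDerivAt (fun x => ∫ y, u (x, y) ∂ν)
      (∫ y, (fderiv ℝ u (x, y)).comp (ContinuousLinearMap.inl ℝ E F) ∂ν) x := by
  obtain ⟨K, hK⟩ := hu.exists_norm_fderiv_le
  refine hasFDerivAt_integral_of_dominated_of_fderiv_le (F := fun x y => u (x, y))
    (F' := fun x y => (fderiv ℝ u (x, y)).comp (ContinuousLinearMap.inl ℝ E F))
    (bound := fun _ => K * ‖ContinuousLinearMap.inl ℝ E F‖) univ_mem
    (.of_forall fun x => (hu.slice_right x).continuous.aestronglyMeasurable)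
    (hu.slice_right x).integrable ?_ (.of_forall fun y x _ => ?_) (integrable_const _)
    (.of_forall fun y x _ => ?_)
  · have := hu.continuous_fderiv
    exact Continuous.aestronglyMeasurable (by fun_prop)
  · exact (ContinuousLinearMap.opNorm_comp_le _ _).trans (by gcongr; exact hK _)
  · exact (hu.hasFDerivAt (x, y)).comp (f := fun x => (x, y)) x (hasFDerivAt_prodMk_left x y)

/-- All bounds on `u` are uniform, so they survive averaging. Hence the marginal is an admissible
test function for the first factor in the tensorization. -/
theorem IsTame.integral_right (hu : IsTame u) (ν : Measure F) [IsProbabilityMeasure ν] :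
    IsTame fun x => ∫ y, u (x, y) ∂ν := by
  obtain ⟨c, hc, h⟩ := hu.exists_pos_le
  obtain ⟨K, hK⟩ := hu.exists_le
  obtain ⟨K', hK'⟩ := hu.exists_norm_fderiv_le
  have hbound : ∀ x y, ‖(fderiv ℝ u (x, y)).comp (ContinuousLinearMap.inl ℝ E F)‖ ≤
      K' * ‖ContinuousLinearMap.inl ℝ E F‖ := fun x y =>
    (ContinuousLinearMap.opNorm_comp_le _ _).trans (by gcongr; exact hK' _)
  refine ⟨contDiff_one_iff_hasFDerivAt.2 ⟨_, ?_, hu.hasFDerivAt_integral_right ν⟩,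
    ⟨c, hc, fun x => ?_⟩, ⟨K, fun x => ?_⟩, ⟨K' * ‖ContinuousLinearMap.inl ℝ E F‖, fun x => ?_⟩⟩
  · have := hu.continuous_fderiv
    refine continuous_of_dominated (fun x => Continuous.aestronglyMeasurable (by fun_prop))
      (fun x => .of_forall (hbound x)) (integrable_const _) (.of_forall fun y => by fun_prop)
  · simpa using integral_mono (μ := ν) (integrable_const c) (hu.slice_right x).integrable fun y => h (x, y)
  · simpa using integral_mono (μ := ν) (hu.slice_right x).integrable (integrable_const K) fun y => hK (x, y)
  · rw [(hu.hasFDerivAt_integral_right ν x).fderiv]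
    simpa using norm_integral_le_of_norm_le_const (μ := ν) (.of_forall (hbound x))

theorem IsTame.fderiv_integral_right_apply (hu : IsTame u) (ν : Measure F)
    [IsProbabilityMeasure ν] (x : E) (v : E) :
    fderiv ℝ (fun x => ∫ y, u (x, y) ∂ν) x v = ∫ y, fderiv ℝ u (x, y) (v, 0) ∂ν := by
  obtain ⟨K, hK⟩ := hu.exists_norm_fderiv_le
  have := hu.continuous_fderiv
  rw [(hu.hasFDerivAt_integral_right ν x).fderiv, ContinuousLinearMap.integral_apply]
  · simp
  · refine .of_bound (Continuous.aestronglyMeasurable (by fun_prop))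
      (K * ‖ContinuousLinearMap.inl ℝ E F‖) (.of_forall fun y => ?_)
    exact (ContinuousLinearMap.opNorm_comp_le _ _).trans (by gcongr; exact hK _)

variable [MeasurableSpace E] [BorelSpace E] [SecondCountableTopology E]

/-- Tensorization of the logarithmic Sobolev inequality. -/
theorem TameLSI.prod {ι κ : Type*} [Fintype ι] [Fintype κ] {μ : Measure E} {ν : Measure F}
    [IsProbabilityMeasure μ] [IsProbabilityMeasure ν] {v : ι → E} {w : κ → F}
    (hμ : TameLSI μ v) (hν : TameLSI ν w) :
    TameLSI (μ.prod ν) (Sum.elim (fun i => (v i, (0 : F))) fun j => ((0 : E), w j)) := by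
  intro u hu
  set G : E → ℝ := fun x => ∫ y, u (x, y) ∂ν with hG
  have hGt : IsTame G := hu.integral_right ν
  have hI1 : Integrable (fun z => (∑ i, fderiv ℝ u z (v i, 0) ^ 2) / u z) (μ.prod ν) :=
    hu.integrable_sum_fderiv_apply_sq_div _
  have hI2 : Integrable (fun z => (∑ j, fderiv ℝ u z (0, w j) ^ 2) / u z) (μ.prod ν) :=
    hu.integrable_sum_fderiv_apply_sq_div _
  have hEnt : Integrable (fun z => u z * Real.log (u z)) (μ.prod ν) := hu.integrable_mul_log
  -- The inequality for `ν` on each slice leaves the entropy of the marginal `G`, to which the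
  -- inequality for `μ` applies.
  have hstep1 : ∀ x, ∫ y, u (x, y) * Real.log (u (x, y)) ∂ν ≤ G x * Real.log (G x) +
      1 / 2 * ∫ y, (∑ j, fderiv ℝ u (x, y) (0, w j) ^ 2) / u (x, y) ∂ν := by
    intro x
    have h := hν _ (hu.slice_right x)
    simp only [hu.fderiv_slice_right, ContinuousLinearMap.comp_apply,
      ContinuousLinearMap.inr_apply] at h
    linarith
  -- Cauchy–Schwarz in each direction: the Fisher information of `G` is at most the averaged one of
  -- `u`.
  have hstep2 : ∀ x, (∑ i, fderiv ℝ G x (v i) ^ 2) / G x ≤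
      ∫ y, (∑ i, fderiv ℝ u (x, y) (v i, 0) ^ 2) / u (x, y) ∂ν := by
    intro x
    have hx := hu.slice_right x
    have hbd : ∀ i, Integrable (fun y => fderiv ℝ u (x, y) (v i, 0)) ν ∧
        Integrable (fun y => fderiv ℝ u (x, y) (v i, 0) ^ 2 / u (x, y)) ν := by
      intro i
      obtain ⟨c, hc, h⟩ := hu.exists_pos_le
      obtain ⟨K, hK⟩ := hu.exists_norm_fderiv_le
      have hcont := hu.continuous_fderiv
      have hle : ∀ y, ‖fderiv ℝ u (x, y) (v i, 0)‖ ≤ K * ‖(v i, (0 : F))‖ := fun y =>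
        ((fderiv ℝ u (x, y)).le_opNorm _).trans (by gcongr; exact hK _)
      refine ⟨.of_bound (Continuous.aestronglyMeasurable (by fun_prop)) _ (.of_forall hle),
        .of_bound (Continuous.aestronglyMeasurable
          ((hu.continuous_fderiv_apply_sq_div (v i, 0)).comp (Continuous.prodMk_right x)))
          ((K * ‖(v i, (0 : F))‖) ^ 2 / c) (.of_forall fun y => ?_)⟩
      have := hu.pos (x, y)
      rw [Real.norm_of_nonneg (by positivity), ← sq_abs, ← Real.norm_eq_abs]
      gcongr
      · exact hle y
      · exact h _
    simp_rw [Finset.sum_div]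
    rw [integral_finsetSum _ fun i _ => (hbd i).2]
    refine Finset.sum_le_sum fun i _ => ?_
    rw [hG, hu.fderiv_integral_right_apply]
    exact sq_integral_div_le_integral_sq_div (fun y => hu.pos (x, y)) hx.integrable (hbd i).1
      (hbd i).2 (hGt.pos x)
  have hGlsi := hμ G hGt
  have hGI : ∫ z, u z ∂(μ.prod ν) = ∫ x, G x ∂μ := integral_prod _ hu.integrable
  have h1 : ∫ z, u z * Real.log (u z) ∂(μ.prod ν) ≤ ∫ x, G x * Real.log (G x) ∂μ +
      1 / 2 * ∫ z, (∑ j, fderiv ℝ u z (0, w j) ^ 2) / u z ∂(μ.prod ν) := by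
    rw [integral_prod _ hEnt, integral_prod _ hI2, ← integral_const_mul,
      ← integral_add hGt.integrable_mul_log (hI2.integral_prod_left.const_mul _)]
    exact integral_mono hEnt.integral_prod_left
      (hGt.integrable_mul_log.add (hI2.integral_prod_left.const_mul _)) hstep1
  have h2 : ∫ x, (∑ i, fderiv ℝ G x (v i) ^ 2) / G x ∂μ ≤
      ∫ z, (∑ i, fderiv ℝ u z (v i, 0) ^ 2) / u z ∂(μ.prod ν) := by
    rw [integral_prod _ hI1]
    exact integral_mono (hGt.integrable_sum_fderiv_apply_sq_div v) hI1.integral_prod_left hstep2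
  have h3 : ∫ z, (∑ k, fderiv ℝ u z
      (Sum.elim (fun i => (v i, (0 : F))) (fun j => ((0 : E), w j)) k) ^ 2) / u z ∂(μ.prod ν) =
      (∫ z, (∑ i, fderiv ℝ u z (v i, 0) ^ 2) / u z ∂(μ.prod ν)) +
        ∫ z, (∑ j, fderiv ℝ u z (0, w j) ^ 2) / u z ∂(μ.prod ν) := by
    rw [← integral_add hI1 hI2]
    simp [Fintype.sum_sum_type, add_div]
  rw [hGI, h3]
  linarith

end Product

end Tame

/-! ### Gaussian measures -/

/-- Let the interval `[-(n+1), n+1]` exhaust the line in the interval inequality; tameness makes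
every integral converge. -/
theorem tameLSI_gaussianReal_zero_one :
    TameLSI (gaussianReal 0 1) fun _ : Unit => (1 : ℝ) := by
  intro u hu
  have hu' : ∀ x, HasDerivAt u (fderiv ℝ u x 1) x := fun x => (hu.hasFDerivAt x).hasDerivAt
  have hu'c : Continuous fun x => fderiv ℝ u x 1 := hu.continuous_fderiv.clm_apply continuous_const
  set c : ℝ := (√(2 * Real.pi))⁻¹ with hc
  have hc_pos : 0 < c := by positivity
  have hpdf : ∀ x, gaussianPDFReal 0 1 x = c * Real.exp (-x ^ 2 / 2) := by
    intro x
    simp [gaussianPDFReal, hc]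
  have hint : ∀ f : ℝ → ℝ, ∫ x, f x ∂(gaussianReal 0 1) = c * ∫ x, f x * Real.exp (-x ^ 2 / 2) := by
    intro f
    rw [integral_gaussianReal_eq_integral_smul one_ne_zero, ← integral_const_mul]
    congr with x
    rw [hpdf, smul_eq_mul]
    ring
  have hintegrable : ∀ f : ℝ → ℝ, Integrable f (gaussianReal 0 1) →
      Integrable fun x => f x * Real.exp (-x ^ 2 / 2) := by
    intro f hf
    rw [gaussianReal_of_var_ne_zero _ one_ne_zero, integrable_withDensity_iff
      (measurable_gaussianPDF 0 1) (ae_of_all _ fun _ => gaussianPDF_lt_top)] at hf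
    refine (hf.const_mul c⁻¹).congr (ae_of_all _ fun x => ?_)
    simp only [toReal_gaussianPDF, hpdf]
    field_simp
  have hZ : c * ∫ x : ℝ, Real.exp (-x ^ 2 / 2) = 1 := by
    have := hint fun _ => 1
    simpa using this.symm
  have hZint : Integrable fun x : ℝ => Real.exp (-x ^ 2 / 2) := by
    simpa using hintegrable (fun _ => 1) (integrable_const _)
  have hlim : ∀ f : ℝ → ℝ, Integrable f →
      Tendsto (fun n : ℕ => ∫ x in (-((n : ℝ) + 1))..((n : ℝ) + 1), f x) atTop (𝓝 (∫ x, f x)) := by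
    intro f hf
    have h1 : Tendsto (fun n : ℕ => (n : ℝ) + 1) atTop atTop :=
      tendsto_atTop_add_const_right _ _ tendsto_natCast_atTop_atTop
    exact intervalIntegral_tendsto_integral hf (tendsto_neg_atTop_atBot.comp h1) h1
  have hA : 0 < ∫ x, u x * Real.exp (-x ^ 2 / 2) := by
    have h : 0 < ∫ x, u x ∂(gaussianReal 0 1) := by
      obtain ⟨b, hb, h⟩ := hu.exists_pos_le
      have := integral_mono (μ := gaussianReal 0 1) (integrable_const b) hu.integrable h
      simp at this
      linarith
    rw [hint] at h
    exact pos_of_mul_pos_right h hc_pos.le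
  have hZ_pos : 0 < ∫ x : ℝ, Real.exp (-x ^ 2 / 2) := by
    have : 0 < c * ∫ x : ℝ, Real.exp (-x ^ 2 / 2) := by rw [hZ]; exact one_pos
    exact pos_of_mul_pos_right this hc_pos.le
  have key := le_of_tendsto_of_tendsto'
    (((hlim _ (hintegrable _ hu.integrable_mul_log)).sub
      ((hlim _ (hintegrable _ hu.integrable)).mul
        (((hlim _ (hintegrable _ hu.integrable)).div (hlim _ hZint) hZ_pos.ne').log
          (div_pos hA hZ_pos).ne'))))
    (hlim _ (hintegrable _ ((hu.integrable_fderiv_apply_sq_div 1).const_mul (1 / 2))))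
    (fun n => by
      have := integral_mul_log_sub_le (u := u) (R := (n : ℝ) + 1) (by positivity) hu' hu'c hu.pos
      refine this.trans_eq (intervalIntegral.integral_congr fun x _ => ?_)
      have := (hu.pos x).ne'
      field_simp)
  -- The factor `c` normalizes the weight, so the mean in the logarithm is the Gaussian expectation
  -- of `u`.
  have hdiv : (∫ x, u x * Real.exp (-x ^ 2 / 2)) / ∫ x : ℝ, Real.exp (-x ^ 2 / 2) =
      c * ∫ x, u x * Real.exp (-x ^ 2 / 2) := by
    rw [div_eq_iff hZ_pos.ne', mul_right_comm, hZ, one_mul]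
  rw [hdiv] at key
  simp only [Finset.univ_unique, Finset.sum_singleton]
  rw [← integral_const_mul (1 / 2 : ℝ), hint, hint, hint]
  have := mul_le_mul_of_nonneg_left key hc_pos.le
  linarith

/-- The directions enter only through the quadratic form `L ↦ ∑ i, L (v i) ^ 2`, so families with
the same form are interchangeable. -/
theorem TameLSI.of_sum_eq {E : Type*} [NormedAddCommGroup E] [NormedSpace ℝ E] [MeasurableSpace E]
    {ι κ : Type*} [Fintype ι] [Fintype κ] {μ : Measure E} {v : ι → E}
    {w : κ → E} (h : TameLSI μ v)
    (hvw : ∀ L : E →L[ℝ] ℝ, ∑ i, L (v i) ^ 2 = ∑ j, L (w j) ^ 2) : TameLSI μ w := by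
  intro u hu
  simp_rw [← hvw]
  exact h u hu

theorem tameLSI_gaussianReal_zero (v : ℝ≥0) :
    TameLSI (gaussianReal 0 v) fun _ : Unit => √(v : ℝ) := by
  have h := tameLSI_gaussianReal_zero_one.map_add_clm 0
    (ContinuousLinearMap.mul ℝ ℝ √(v : ℝ))
  have hmap := gaussianReal_map_const_mul (μ := 0) (v := 1) √(v : ℝ)
  have hv : NNReal.mk (√(v : ℝ) ^ 2) (sq_nonneg _) = v := by
    ext
    simp
  rw [hv, mul_zero, mul_one] at hmap
  simpa [hmap] using h

/-- Induction on the dimension: split off coordinate `0`, tensorize, and transport along `Fin.cons`.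
In dimension zero the space is a point and both sides vanish. -/
theorem tameLSI_pi_gaussianReal {d : ℕ} (v : Fin d → ℝ≥0) :
    TameLSI (Measure.pi fun i => gaussianReal 0 (v i))
      fun i => (Pi.single i √(v i : ℝ) : Fin d → ℝ) := by
  induction d with
  | zero =>
    intro u hu
    rw [Measure.pi_of_empty _ 0]
    simp
  | succ d ih =>
    have h := ((tameLSI_gaussianReal_zero (v 0)).prod (ih fun i => v i.succ)).map_add_clm 0
      (Fin.consEquivL ℝ fun _ : Fin (d + 1) => ℝ).toContinuousLinearMap
    have hmap : ((gaussianReal 0 (v 0)).prod (Measure.pi fun i => gaussianReal 0 (v i.succ))).map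
        (fun x => 0 + (Fin.consEquivL ℝ fun _ : Fin (d + 1) => ℝ).toContinuousLinearMap x) =
        Measure.pi fun i => gaussianReal 0 (v i) := by
      have := ((measurePreserving_piFinSuccAbove (fun i => gaussianReal 0 (v i)) 0).symm).map_eq
      rw [← this]
      congr 1
      ext x i
      simp [MeasurableEquiv.piFinSuccAbove, Fin.insertNthEquiv]
    rw [hmap] at h
    refine h.of_sum_eq fun L => ?_
    rw [Fintype.sum_sum_type, Fin.sum_univ_succ]
    congr 1
    · simp only [Finset.univ_unique, Finset.sum_singleton, Sum.elim_inl]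
      congr 2
      ext i
      refine Fin.cases ?_ (fun i => ?_) i <;> simp
    · refine Finset.sum_congr rfl fun j _ => ?_
      simp only [Sum.elim_inr]
      congr 2
      ext i
      refine Fin.cases ?_ (fun i => ?_) i <;> simp [Pi.single_apply]

theorem pi_gaussianReal_eq_withDensity {d : ℕ} {v : Fin d → ℝ≥0} (hv : ∀ i, v i ≠ 0) :
    (Measure.pi fun i => gaussianReal 0 (v i)) =
      volume.withDensity fun x => ENNReal.ofReal (∏ i, gaussianPDFReal 0 (v i) (x i)) := by
  refine Measure.pi_eq fun s hs => ?_
  rw [withDensity_apply _ (.univ_pi hs), volume_pi, Measure.restrict_pi_pi,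
    ← ofReal_integral_eq_lintegral_ofReal, integral_fintype_prod_eq_prod, ENNReal.ofReal_prod_of_nonneg]
  · exact Finset.prod_congr rfl fun i _ => (gaussianReal_apply_eq_integral _ (hv i) _).symm
  · exact fun i _ => integral_nonneg fun x => gaussianPDFReal_nonneg _ _ _
  · exact .fintype_prod fun i => (integrable_gaussianPDFReal 0 (v i)).integrableOn
  · exact ae_of_all _ fun x => Finset.prod_nonneg fun i _ => gaussianPDFReal_nonneg _ _ _

/-! ### Powers of Gaussian densities -/

section

variable {d : ℕ}

/-- The value of `∫ q(x; m, S) ^ b dx`. -/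
noncomputable def gaussianPowIntegral (S : Matrix (Fin d) (Fin d) ℝ) (b : ℝ) : ℝ :=
  ((2 * Real.pi) ^ ((d : ℝ) / 2) * √S.det)⁻¹ ^ b * ((2 * Real.pi / b) ^ ((d : ℝ) / 2) * √S.det)

variable {S : Matrix (Fin d) (Fin d) ℝ} {b : ℝ}

theorem gaussianPowIntegral_pos (hS : S.PosDef) (hb : 0 < b) : 0 < gaussianPowIntegral S b := by
  have := hS.det_pos
  have := Real.pi_pos
  unfold gaussianPowIntegral
  positivity

theorem gaussianDensity_pos (m : EuclideanSpace ℝ (Fin d)) (hS : S.PosDef)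
    (x : EuclideanSpace ℝ (Fin d)) : 0 < gaussianDensity m S x := by
  have := hS.det_pos
  have := Real.pi_pos
  unfold gaussianDensity
  positivity

theorem continuous_gaussianDensity (m : EuclideanSpace ℝ (Fin d)) (S : Matrix (Fin d) (Fin d) ℝ) :
    Continuous (gaussianDensity m S) := by
  unfold gaussianDensity
  have h1 : Continuous fun x : EuclideanSpace ℝ (Fin d) => (x - m).ofLp := by fun_prop
  have h2 : Continuous fun x : EuclideanSpace ℝ (Fin d) => (S⁻¹).mulVec (x - m).ofLp := by fun_prop
  have h3 := h1.dotProduct h2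
  fun_prop

theorem dotProduct_inv_mulVec (hS : S.PosDef) (y : EuclideanSpace ℝ (Fin d)) :
    y.ofLp ⬝ᵥ (S⁻¹).mulVec y.ofLp =
      ∑ i, hS.isHermitian.eigenvectorBasis.repr y i ^ 2 / hS.isHermitian.eigenvalues i := by
  set e := hS.isHermitian.eigenvectorBasis
  set l := hS.isHermitian.eigenvalues
  have hl : ∀ i, l i ≠ 0 := fun i => (hS.eigenvalues_pos i).ne'
  -- The candidate for `S⁻¹ y`: divide each eigencoordinate of `y` by its eigenvalue.
  set z : EuclideanSpace ℝ (Fin d) := ∑ i, (e.repr y i / l i) • e i with hz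
  have hSz : S.mulVec z.ofLp = y.ofLp := by
    have h : Matrix.toEuclideanLin S z = y := by
      rw [hz, map_sum]
      conv_rhs => rw [← e.sum_repr y]
      refine Finset.sum_congr rfl fun i _ => ?_
      rw [map_smul]
      have : Matrix.toEuclideanLin S (e i) = l i • e i := by
        ext j
        have := congrFun (hS.isHermitian.mulVec_eigenvectorBasis i) j
        simpa [Matrix.toLpLin_apply] using this
      rw [this, smul_smul, div_mul_cancel₀ _ (hl i)]
    rw [← h]
    rfl
  have hzy : (S⁻¹).mulVec y.ofLp = z.ofLp := by
    rw [← hSz, Matrix.mulVec_mulVec, Matrix.nonsing_inv_mul _ hS.det_pos.ne'.isUnit,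
      Matrix.one_mulVec]
  have hinner : y.ofLp ⬝ᵥ z.ofLp = inner ℝ z y := by
    simp [EuclideanSpace.inner_eq_star_dotProduct]
  rw [hzy, hinner, hz, sum_inner]
  refine Finset.sum_congr rfl fun i _ => ?_
  rw [real_inner_smul_left, e.repr_apply_apply]
  ring

theorem gaussianDensity_le (m : EuclideanSpace ℝ (Fin d)) (hS : S.PosDef)
    (x : EuclideanSpace ℝ (Fin d)) :
    gaussianDensity m S x ≤ ((2 * Real.pi) ^ ((d : ℝ) / 2) * √S.det)⁻¹ := by
  have := hS.det_pos
  have := Real.pi_pos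
  unfold gaussianDensity
  refine mul_le_of_le_one_right (by positivity) (Real.exp_le_one_iff.2 ?_)
  rw [dotProduct_inv_mulVec hS]
  have : 0 ≤ ∑ i, hS.isHermitian.eigenvectorBasis.repr (x - m) i ^ 2 /
      hS.isHermitian.eigenvalues i :=
    Finset.sum_nonneg fun i _ => div_nonneg (sq_nonneg _) (hS.eigenvalues_pos i).le
  linarith

/-- The eigenvalues of the covariance matrix `S / b`. -/
noncomputable def scaledVariance (hS : S.PosDef) (hb : 0 < b) (i : Fin d) : ℝ≥0 :=
  ⟨hS.isHermitian.eigenvalues i / b, (div_pos (hS.eigenvalues_pos i) hb).le⟩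

theorem coe_scaledVariance (hS : S.PosDef) (hb : 0 < b) (i : Fin d) :
    (scaledVariance hS hb i : ℝ) = hS.isHermitian.eigenvalues i / b := rfl

theorem scaledVariance_ne_zero (hS : S.PosDef) (hb : 0 < b) (i : Fin d) :
    scaledVariance hS hb i ≠ 0 := by
  rw [← NNReal.coe_ne_zero, coe_scaledVariance]
  exact (div_pos (hS.eigenvalues_pos i) hb).ne'

/-- In eigencoordinates the quadratic form is diagonal, and raising to the power `b` divides each
variance by `b`; the powers of `2π` and the determinant supply the one-dimensional normalizations.
-/
theorem gaussianDensity_rpow_div (m : EuclideanSpace ℝ (Fin d)) (hS : S.PosDef) (hb : 0 < b)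
    (x : EuclideanSpace ℝ (Fin d)) :
    gaussianDensity m S x ^ b / gaussianPowIntegral S b =
      ∏ i, gaussianPDFReal 0 (scaledVariance hS hb i)
        (hS.isHermitian.eigenvectorBasis.repr (x - m) i) := by
  have hdet := hS.det_pos
  have hpi := Real.pi_pos
  set e := hS.isHermitian.eigenvectorBasis
  set l := hS.isHermitian.eigenvalues with hl
  have hl_pos : ∀ i, 0 < l i := hS.eigenvalues_pos
  set N : ℝ := ((2 * Real.pi) ^ ((d : ℝ) / 2) * √S.det)⁻¹ with hN
  have hN_pos : 0 < N := by positivity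
  have hQ : (x - m).ofLp ⬝ᵥ (S⁻¹).mulVec (x - m).ofLp = ∑ i, e.repr (x - m) i ^ 2 / l i :=
    dotProduct_inv_mulVec hS (x - m)
  have hq : gaussianDensity m S x ^ b =
      N ^ b * ∏ i, Real.exp (-(e.repr (x - m) i ^ 2) / (2 * (l i / b))) := by
    unfold gaussianDensity
    rw [Real.mul_rpow hN_pos.le (Real.exp_pos _).le, ← Real.exp_mul, ← Real.exp_sum,
      hQ, Finset.mul_sum, Finset.sum_mul]
    congr 2
    refine Finset.sum_congr rfl fun i _ => ?_
    have := hl_pos i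
    field_simp
  have hprod : ∏ i, √(2 * Real.pi * (l i / b)) = (2 * Real.pi / b) ^ ((d : ℝ) / 2) * √S.det := by
    have hd : S.det = ∏ i, l i := by simpa using hS.isHermitian.det_eq_prod_eigenvalues
    have h1 : ∀ i, √(2 * Real.pi * (l i / b)) = √(2 * Real.pi / b) * √(l i) := by
      intro i
      rw [← Real.sqrt_mul (by positivity)]
      congr 1
      ring
    simp_rw [h1]
    rw [Finset.prod_mul_distrib, Finset.prod_const, Finset.card_univ, Fintype.card_fin, hd,
      ← Real.sqrt_prod _ fun i _ => (hl_pos i).le, Real.sqrt_eq_rpow, ← Real.rpow_natCast,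
      ← Real.rpow_mul (by positivity)]
    congr 2
    ring
  have hpdf : ∀ i, gaussianPDFReal 0 (scaledVariance hS hb i) (e.repr (x - m) i) =
      (√(2 * Real.pi * (l i / b)))⁻¹ *
        Real.exp (-(e.repr (x - m) i ^ 2) / (2 * (l i / b))) := by
    intro i
    rw [gaussianPDFReal, coe_scaledVariance, sub_zero]
  simp_rw [hpdf]
  rw [Finset.prod_mul_distrib, Finset.prod_inv_distrib, hprod, hq, gaussianPowIntegral, ← hN]
  rw [mul_comm (N ^ b) (∏ _, _), mul_comm (N ^ b) (_ * _), mul_div_mul_right _ _ (by positivity),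
    div_eq_inv_mul]

/-- The Gaussian law with density proportional to `q(x; m, S) ^ b`. -/
noncomputable def gaussianPowLaw (m : EuclideanSpace ℝ (Fin d)) (S : Matrix (Fin d) (Fin d) ℝ)
    (b : ℝ) : Measure (EuclideanSpace ℝ (Fin d)) :=
  volume.withDensity fun x =>
    ENNReal.ofReal (gaussianDensity m S x ^ b / gaussianPowIntegral S b)

theorem continuous_gaussianDensity_rpow (m : EuclideanSpace ℝ (Fin d)) (hS : S.PosDef) (b : ℝ) :
    Continuous fun x => gaussianDensity m S x ^ b :=
  (continuous_gaussianDensity m S).rpow_const fun x => .inl (gaussianDensity_pos m hS x).ne'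

/-- The linear map `y ↦ ∑ i, y i • e i` for the eigenvector basis `e` of `S`. -/
noncomputable def eigenvectorMap (hS : S.PosDef) : (Fin d → ℝ) →L[ℝ] EuclideanSpace ℝ (Fin d) :=
  hS.isHermitian.eigenvectorBasis.repr.symm.toContinuousLinearEquiv.toContinuousLinearMap.comp
    (PiLp.continuousLinearEquiv 2 ℝ fun _ : Fin d => ℝ).symm.toContinuousLinearMap

theorem eigenvectorMap_apply (hS : S.PosDef) (y : Fin d → ℝ) :
    eigenvectorMap hS y = hS.isHermitian.eigenvectorBasis.repr.symm (WithLp.toLp 2 y) := rfl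

/-- The eigenvector map is an isometry followed by a translation, so it preserves volume and the
product density is simply transported. -/
theorem map_pi_gaussianReal (m : EuclideanSpace ℝ (Fin d)) (hS : S.PosDef) (hb : 0 < b) :
    (Measure.pi fun i => gaussianReal 0 (scaledVariance hS hb i)).map
      (fun y => m + eigenvectorMap hS y) = gaussianPowLaw m S b := by
  have hmp : MeasurePreserving (fun y => m + eigenvectorMap hS y) volume volume :=
    (measurePreserving_add_left volume m).comp
      ((hS.isHermitian.eigenvectorBasis.measurePreserving_repr_symm).comp
        (PiLp.volume_preserving_toLp (Fin d)))
  have hdens : ∀ y : Fin d → ℝ, ∏ i, gaussianPDFReal 0 (scaledVariance hS hb i) (y i) =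
      gaussianDensity m S (m + eigenvectorMap hS y) ^ b / gaussianPowIntegral S b := by
    intro y
    rw [gaussianDensity_rpow_div m hS hb]
    simp [eigenvectorMap_apply]
  rw [pi_gaussianReal_eq_withDensity (scaledVariance_ne_zero hS hb)]
  simp_rw [hdens]
  ext s hs
  rw [Measure.map_apply hmp.measurable hs, withDensity_apply _ (hmp.measurable hs), gaussianPowLaw,
    withDensity_apply _ hs]
  refine hmp.setLIntegral_comp_preimage hs (f := fun x =>
    ENNReal.ofReal (gaussianDensity m S x ^ b / gaussianPowIntegral S b)) ?_
  exact ((continuous_gaussianDensity_rpow m hS b).div_const _).measurable.ennreal_ofReal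

theorem isProbabilityMeasure_gaussianPowLaw (m : EuclideanSpace ℝ (Fin d)) (hS : S.PosDef)
    (hb : 0 < b) : IsProbabilityMeasure (gaussianPowLaw m S b) := by
  rw [← map_pi_gaussianReal m hS hb]
  exact Measure.isProbabilityMeasure_map (by fun_prop)

/-- No integral is computed: the normalized density is the image of a product of probability laws,
so its total mass is one. -/
theorem lintegral_gaussianDensity_rpow (m : EuclideanSpace ℝ (Fin d)) (hS : S.PosDef)
    (hb : 0 < b) :
    ∫⁻ x, ENNReal.ofReal (gaussianDensity m S x ^ b) =
      ENNReal.ofReal (gaussianPowIntegral S b) := by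
  have hI := gaussianPowIntegral_pos hS hb
  have h := (isProbabilityMeasure_gaussianPowLaw m hS hb).measure_univ
  rw [gaussianPowLaw, withDensity_apply _ .univ, Measure.restrict_univ] at h
  have hmeas := (continuous_gaussianDensity_rpow m hS b).measurable.ennreal_ofReal
  simp_rw [div_eq_mul_inv, mul_comm _ (gaussianPowIntegral S b)⁻¹,
    ENNReal.ofReal_mul (inv_pos.2 hI).le] at h
  rw [lintegral_const_mul _ hmeas] at h
  calc _ = ENNReal.ofReal (gaussianPowIntegral S b) *
        (ENNReal.ofReal (gaussianPowIntegral S b)⁻¹ *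
          ∫⁻ x, ENNReal.ofReal (gaussianDensity m S x ^ b)) := by
        rw [← mul_assoc, ← ENNReal.ofReal_mul hI.le, mul_inv_cancel₀ hI.ne', ENNReal.ofReal_one,
          one_mul]
    _ = _ := by rw [h, mul_one]

theorem integrable_gaussianDensity_rpow (m : EuclideanSpace ℝ (Fin d)) (hS : S.PosDef)
    (hb : 0 < b) : Integrable fun x => gaussianDensity m S x ^ b := by
  rw [← lintegral_ofReal_ne_top_iff_integrable
    (continuous_gaussianDensity_rpow m hS b).aestronglyMeasurable
    (ae_of_all _ fun x => Real.rpow_nonneg (gaussianDensity_pos m hS x).le _),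
    lintegral_gaussianDensity_rpow m hS hb]
  exact ENNReal.ofReal_ne_top

theorem integral_gaussianDensity_rpow (m : EuclideanSpace ℝ (Fin d)) (hS : S.PosDef)
    (hb : 0 < b) : ∫ x, gaussianDensity m S x ^ b = gaussianPowIntegral S b := by
  rw [integral_eq_lintegral_of_nonneg_ae
    (ae_of_all _ fun x => Real.rpow_nonneg (gaussianDensity_pos m hS x).le _)
    (continuous_gaussianDensity_rpow m hS b).aestronglyMeasurable,
    lintegral_gaussianDensity_rpow m hS hb,
    ENNReal.toReal_ofReal (gaussianPowIntegral_pos hS hb).le]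

/-! ### Gaussian laws with general covariance -/

/-- The logarithmic Sobolev inequality with constant `C` for tame functions. -/
def TameLSIWith (μ : Measure (EuclideanSpace ℝ (Fin d))) (C : ℝ) : Prop :=
  ∀ u : EuclideanSpace ℝ (Fin d) → ℝ, IsTame u →
    ∫ x, u x * Real.log (u x) ∂μ - (∫ x, u x ∂μ) * Real.log (∫ x, u x ∂μ) ≤
      C / 2 * ∫ x, ‖fderiv ℝ u x‖ ^ 2 / u x ∂μ

theorem IsTame.integrable_norm_fderiv_sq_div {E : Type*} [NormedAddCommGroup E] [NormedSpace ℝ E]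
    [MeasurableSpace E] [BorelSpace E] {μ : Measure E} [IsFiniteMeasure μ] {u : E → ℝ}
    (hu : IsTame u) : Integrable (fun x => ‖fderiv ℝ u x‖ ^ 2 / u x) μ := by
  obtain ⟨c, hc, h⟩ := hu.exists_pos_le
  obtain ⟨K, hK⟩ := hu.exists_norm_fderiv_le
  refine .of_bound ((hu.continuous_fderiv.norm.pow 2).div hu.continuous
    fun x => (hu.pos x).ne').aestronglyMeasurable (K ^ 2 / c) (.of_forall fun x => ?_)
  have hx := hu.pos x
  rw [Real.norm_of_nonneg (by positivity)]
  gcongr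
  · exact hK x
  · exact h x

theorem tameLSIWith_gaussianPowLaw (m : EuclideanSpace ℝ (Fin d)) (hS : S.PosDef) (hb : 0 < b) :
    TameLSIWith (gaussianPowLaw m S b) ((⨆ i, hS.isHermitian.eigenvalues i) / b) := by
  have := isProbabilityMeasure_gaussianPowLaw m hS hb
  have h := (tameLSI_pi_gaussianReal (scaledVariance hS hb)).map_add_clm m (eigenvectorMap hS)
  rw [map_pi_gaussianReal m hS hb] at h
  intro u hu
  refine (h u hu).trans ?_
  rw [← integral_const_mul, ← integral_const_mul]
  refine integral_mono ((hu.integrable_sum_fderiv_apply_sq_div _).const_mul _)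
    (hu.integrable_norm_fderiv_sq_div.const_mul _) fun x => ?_
  have hx := hu.pos x
  set L := fderiv ℝ u x
  set e := hS.isHermitian.eigenvectorBasis with he
  have hvec : ∀ i, L (eigenvectorMap hS (Pi.single i √(scaledVariance hS hb i : ℝ))) ^ 2 =
      hS.isHermitian.eigenvalues i / b * L (e i) ^ 2 := by
    intro i
    have : eigenvectorMap hS (Pi.single i √(scaledVariance hS hb i : ℝ)) =
        √(scaledVariance hS hb i : ℝ) • e i := by
      rw [eigenvectorMap_apply, ← he, LinearIsometryEquiv.symm_apply_eq, map_smul, e.repr_self]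
      ext j
      by_cases hij : j = i
      · subst hij
        simp
      · simp [hij]
    rw [this, map_smul, smul_eq_mul, mul_pow, Real.sq_sqrt NNReal.zero_le_coe, coe_scaledVariance]
  -- Parseval: in the eigenbasis the sum is a weighted form of `‖L‖²` with weights `l_i / b`,
  -- bounded by the largest one.
  have hle : ∑ i, L (eigenvectorMap hS (Pi.single i √(scaledVariance hS hb i : ℝ))) ^ 2 ≤
      (⨆ i, hS.isHermitian.eigenvalues i) / b * ‖L‖ ^ 2 := by
    simp_rw [hvec]
    rw [e.norm_dual, Finset.mul_sum]
    refine Finset.sum_le_sum fun i _ => ?_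
    gcongr
    exact le_ciSup (Set.finite_range _).bddAbove i
  calc _ ≤ 1 / 2 * (((⨆ i, hS.isHermitian.eigenvalues i) / b * ‖L‖ ^ 2) / u x) := by gcongr
    _ = _ := by ring

end

/-! ### Bounded perturbations and general test functions -/

section

variable {d : ℕ}

/-- The Holley–Stroock perturbation principle. -/
theorem TameLSIWith.withDensity {μ : Measure (EuclideanSpace ℝ (Fin d))} [IsProbabilityMeasure μ]
    {C a b : ℝ} (hμ : TameLSIWith μ C) (hC : 0 ≤ C) {h : EuclideanSpace ℝ (Fin d) → ℝ}
    (hh : Continuous h) (ha : 0 < a) (hah : ∀ x, a ≤ h x) (hhb : ∀ x, h x ≤ b)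
    [IsProbabilityMeasure (μ.withDensity fun x => ENNReal.ofReal (h x))] :
    TameLSIWith (μ.withDensity fun x => ENNReal.ofReal (h x)) (b / a * C) := by
  intro u hu
  set ν := μ.withDensity fun x => ENNReal.ofReal (h x) with hν
  have hpos : ∀ x, 0 ≤ h x := fun x => ha.le.trans (hah x)
  have hb : 0 < b := ha.trans_le ((hah 0).trans (hhb 0))
  have hint : ∀ f : EuclideanSpace ℝ (Fin d) → ℝ, ∫ x, f x ∂ν = ∫ x, h x * f x ∂μ := by
    intro f
    rw [hν, integral_withDensity_eq_integral_toReal_smul hh.measurable.ennreal_ofReal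
      (ae_of_all _ fun _ => ENNReal.ofReal_lt_top)]
    simp only [ENNReal.toReal_ofReal (hpos _), smul_eq_mul]
  have hmul : ∀ f : EuclideanSpace ℝ (Fin d) → ℝ, Integrable f μ →
      Integrable (fun x => h x * f x) μ := fun f hf =>
    hf.bdd_mul hh.aestronglyMeasurable (c := b) (ae_of_all _ fun x => by
      rw [Real.norm_of_nonneg (hpos x)]
      exact hhb x)
  have hmass : ∀ (ρ : Measure (EuclideanSpace ℝ (Fin d))) [IsProbabilityMeasure ρ],
      0 < ∫ x, u x ∂ρ := by
    intro ρ _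
    obtain ⟨c, hc, h⟩ := hu.exists_pos_le
    have := integral_mono (μ := ρ) (integrable_const c) hu.integrable h
    simp at this
    linarith
  set t := ∫ x, u x ∂μ with ht
  set s := ∫ x, u x ∂ν with hs
  have ht_pos : 0 < t := hmass μ
  have hs_pos : 0 < s := hmass ν
  -- `φ` is the Bregman divergence of `u log u` at the `μ`-mean `t`. Its `μ`-integral is the entropy
  -- under `μ`. Under `ν` it only overestimates the entropy, since the optimal constant there is
  -- `s`. Being nonnegative pointwise, it can be compared under a change of density.
  set φ : EuclideanSpace ℝ (Fin d) → ℝ := fun x =>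
    u x * Real.log (u x) - Real.log t * u x - u x + t with hφ
  have hφ_nonneg : ∀ x, 0 ≤ φ x := by
    intro x
    have hx := hu.pos x
    have h1 := Real.log_le_sub_one_of_pos (div_pos ht_pos hx)
    rw [Real.log_div ht_pos.ne' hx.ne', le_sub_iff_add_le, le_div_iff₀ hx] at h1
    simp only [hφ]
    linarith
  have hφ_int : ∀ (ρ : Measure (EuclideanSpace ℝ (Fin d))) [IsProbabilityMeasure ρ],
      Integrable φ ρ ∧ ∫ x, φ x ∂ρ =
        ∫ x, u x * Real.log (u x) ∂ρ - Real.log t * ∫ x, u x ∂ρ - ∫ x, u x ∂ρ + t := by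
    intro ρ _
    have h1 : Integrable (fun x => u x * Real.log (u x)) ρ := hu.integrable_mul_log
    have h2 : Integrable u ρ := hu.integrable
    have h3 : Integrable (fun x => u x * Real.log (u x) - Real.log t * u x) ρ :=
      h1.sub (h2.const_mul _)
    have h4 : Integrable (fun x => u x * Real.log (u x) - Real.log t * u x - u x) ρ := h3.sub h2
    refine ⟨h4.add (integrable_const t), ?_⟩
    simp only [hφ]
    rw [integral_add h4 (integrable_const t), integral_sub h3 h2,
      integral_sub h1 (h2.const_mul _), integral_const_mul]
    simp
  have hlog : s * Real.log t + s ≤ s * Real.log s + t := by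
    have h1 := Real.log_le_sub_one_of_pos (div_pos ht_pos hs_pos)
    rw [Real.log_div ht_pos.ne' hs_pos.ne', le_sub_iff_add_le, le_div_iff₀ hs_pos] at h1
    linarith
  have h1 : ∫ x, u x * Real.log (u x) ∂ν - s * Real.log s ≤ ∫ x, φ x ∂ν := by
    rw [(hφ_int ν).2]
    linarith
  have h2 : ∫ x, φ x ∂ν ≤ b * ∫ x, φ x ∂μ := by
    rw [hint, ← integral_const_mul]
    exact integral_mono (hmul _ (hφ_int μ).1) ((hφ_int μ).1.const_mul b)
      fun x => mul_le_mul_of_nonneg_right (hhb x) (hφ_nonneg x)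
  have h3 : ∫ x, φ x ∂μ ≤ C / 2 * ∫ x, ‖fderiv ℝ u x‖ ^ 2 / u x ∂μ := by
    refine le_trans (le_of_eq ?_) (hμ u hu)
    rw [(hφ_int μ).2]
    ring
  have h4 : a * ∫ x, ‖fderiv ℝ u x‖ ^ 2 / u x ∂μ ≤ ∫ x, ‖fderiv ℝ u x‖ ^ 2 / u x ∂ν := by
    rw [hint, ← integral_const_mul]
    exact integral_mono (hu.integrable_norm_fderiv_sq_div.const_mul a)
      (hmul _ hu.integrable_norm_fderiv_sq_div)
      fun x => mul_le_mul_of_nonneg_right (hah x) (div_nonneg (sq_nonneg _) (hu.pos x).le)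
  calc _ ≤ b * (C / 2 * ∫ x, ‖fderiv ℝ u x‖ ^ 2 / u x ∂μ) :=
        (h1.trans h2).trans (mul_le_mul_of_nonneg_left h3 hb.le)
    _ = b / a * C / 2 * (a * ∫ x, ‖fderiv ℝ u x‖ ^ 2 / u x ∂μ) := by
        field_simp
    _ ≤ _ := mul_le_mul_of_nonneg_left h4 (by positivity)

/-! ### From tame functions to general test functions -/

theorem isTame_sq_add {E : Type*} [NormedAddCommGroup E] [NormedSpace ℝ E] {g : E → ℝ}
    (hg : ContDiff ℝ 1 g) (hgs : HasCompactSupport g) {ε : ℝ} (hε : 0 < ε) :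
    IsTame fun x => g x ^ 2 + ε := by
  have hs : HasCompactSupport fun x => g x ^ 2 := hgs.comp_left (g := fun t => t ^ 2) (by simp)
  have hc : ContDiff ℝ 1 fun x => g x ^ 2 := hg.pow 2
  obtain ⟨K, hK⟩ := hs.exists_bound_of_continuous hc.continuous
  obtain ⟨K', hK'⟩ := (hs.fderiv (𝕜 := ℝ)).exists_bound_of_continuous
    (hc.continuous_fderiv one_ne_zero)
  refine ⟨hc.add contDiff_const, ⟨ε, hε, fun x => by have := sq_nonneg (g x); linarith⟩,
    ⟨K + ε, fun x => ?_⟩, ⟨K', fun x => ?_⟩⟩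
  · have := (le_abs_self _).trans (hK x)
    linarith
  · rw [fderiv_add_const]
    exact hK' x

/-- The derivative of `g² + ε` is `2 g Dg`, and `g² / (g² + ε) ≤ 1`. The factor `4` turns the tame
constant `C / 2` into the `2 C` of the definition. -/
theorem norm_fderiv_sq_add_sq_div_le {E : Type*} [NormedAddCommGroup E] [NormedSpace ℝ E]
    {g : E → ℝ} (hg : ContDiff ℝ 1 g) {ε : ℝ} (hε : 0 < ε) (x : E) :
    ‖fderiv ℝ (fun x => g x ^ 2 + ε) x‖ ^ 2 / (g x ^ 2 + ε) ≤ 4 * ‖fderiv ℝ g x‖ ^ 2 := by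
  have h : fderiv ℝ (fun x => g x ^ 2 + ε) x = (2 * g x) • fderiv ℝ g x := by
    rw [fderiv_add_const, fderiv_fun_pow 2 (hg.differentiable one_ne_zero x)]
    simp
  rw [h, norm_smul, div_le_iff₀ (by positivity), mul_pow, Real.norm_eq_abs, sq_abs]
  nlinarith [mul_nonneg hε.le (sq_nonneg ‖fderiv ℝ g x‖)]

theorem TameLSIWith.entropy_sq_le {ν : Measure (EuclideanSpace ℝ (Fin d))}
    [IsProbabilityMeasure ν] {C : ℝ} (hν : TameLSIWith ν C) (hC : 0 ≤ C)
    {g : EuclideanSpace ℝ (Fin d) → ℝ} (hg : ContDiff ℝ 1 g) (hgs : HasCompactSupport g) {ε : ℝ}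
    (hε : 0 < ε) :
    ∫ x, (g x ^ 2 + ε) * Real.log (g x ^ 2 + ε) ∂ν -
        (∫ x, (g x ^ 2 + ε) ∂ν) * Real.log (∫ x, (g x ^ 2 + ε) ∂ν) ≤
      2 * C * ∫ x, ‖fderiv ℝ g x‖ ^ 2 ∂ν := by
  have hu := isTame_sq_add hg hgs hε
  have hint : Integrable (fun x => ‖fderiv ℝ g x‖ ^ 2) ν := by
    obtain ⟨K, hK⟩ := (hgs.fderiv (𝕜 := ℝ)).exists_bound_of_continuous
      (hg.continuous_fderiv one_ne_zero)
    refine .of_bound ((hg.continuous_fderiv one_ne_zero).norm.pow 2).aestronglyMeasurable (K ^ 2)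
      (ae_of_all _ fun x => ?_)
    rw [Real.norm_of_nonneg (by positivity)]
    exact pow_le_pow_left₀ (norm_nonneg _) (hK x) 2
  refine (hν _ hu).trans ?_
  have : 2 * C * ∫ x, ‖fderiv ℝ g x‖ ^ 2 ∂ν = C / 2 * ∫ x, 4 * ‖fderiv ℝ g x‖ ^ 2 ∂ν := by
    rw [integral_const_mul]
    ring
  rw [this]
  exact mul_le_mul_of_nonneg_left (integral_mono hu.integrable_norm_fderiv_sq_div
    (hint.const_mul 4) (norm_fderiv_sq_add_sq_div_le hg hε)) (by positivity)

/-- Dilations `b (x / (n+1))` of one bump function equal to `1` on the unit ball; the dilation makes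
the gradients decay like `1 / (n+1)`. -/
theorem exists_cutoff (E : Type*) [NormedAddCommGroup E] [InnerProductSpace ℝ E]
    [FiniteDimensional ℝ E] :
    ∃ (χ : ℕ → E → ℝ) (B : ℝ), (∀ n, ContDiff ℝ 1 (χ n)) ∧ (∀ n, HasCompactSupport (χ n)) ∧
      (∀ n x, |χ n x| ≤ 1) ∧ (∀ n x, ‖fderiv ℝ (χ n) x‖ ≤ B * (1 / ((n : ℝ) + 1))) ∧
      ∀ x, ∀ᶠ n in atTop, χ n x = 1 := by
  let b : ContDiffBump (0 : E) := ⟨1, 2, one_pos, one_lt_two⟩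
  have hbc : ContDiff ℝ 1 b := b.contDiff
  obtain ⟨B, hB⟩ := (b.hasCompactSupport.fderiv (𝕜 := ℝ)).exists_bound_of_continuous
    (hbc.continuous_fderiv one_ne_zero)
  have hpos : ∀ n : ℕ, (0 : ℝ) < 1 / ((n : ℝ) + 1) := fun n => Nat.one_div_pos_of_nat
  refine ⟨fun n x => b ((1 / ((n : ℝ) + 1)) • x), B, fun n => ?_, fun n => ?_, fun n x => ?_,
    fun n x => ?_, fun x => ?_⟩
  · exact hbc.comp (contDiff_const_smul _)
  · exact b.hasCompactSupport.comp_smul (hpos n).ne'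
  · rw [abs_of_nonneg b.nonneg]
    exact b.le_one
  · have h := ((hbc.differentiable one_ne_zero ((1 / ((n : ℝ) + 1)) • x)).hasFDerivAt.comp x
      ((hasFDerivAt_id x).const_smul (1 / ((n : ℝ) + 1)))).fderiv
    have h' : fderiv ℝ (fun x => b ((1 / ((n : ℝ) + 1)) • x)) x =
      (1 / ((n : ℝ) + 1)) • fderiv ℝ b ((1 / ((n : ℝ) + 1)) • x) := by
      refine h.trans ?_
      ext v
      simp
    rw [h', norm_smul, Real.norm_of_nonneg (hpos n).le, mul_comm]
    exact mul_le_mul_of_nonneg_right (hB _) (hpos n).le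
  · have hlim : Tendsto (fun n : ℕ => 1 / ((n : ℝ) + 1) * ‖x‖) atTop (𝓝 (0 * ‖x‖)) :=
      tendsto_one_div_add_atTop_nhds_zero_nat.mul_const _
    rw [zero_mul] at hlim
    filter_upwards [hlim.eventually (gt_mem_nhds one_pos)] with n hn
    refine b.one_of_mem_closedBall ?_
    rw [mem_closedBall_zero_iff, norm_smul, Real.norm_of_nonneg (hpos n).le]
    exact hn.le

/-- Fatou's lemma in the form of an upper bound for the integral of a nonnegative limit. -/
theorem integrable_and_integral_le_of_tendsto {α : Type*} [MeasurableSpace α] {ν : Measure α}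
    {F : ℕ → α → ℝ} {f : α → ℝ} {r : ℕ → ℝ} {R : ℝ} (hF : ∀ n, Integrable (F n) ν)
    (hF_nonneg : ∀ n x, 0 ≤ F n x) (hf : AEStronglyMeasurable f ν)
    (hlim : ∀ x, Tendsto (fun n => F n x) atTop (𝓝 (f x))) (hr : ∀ n, ∫ x, F n x ∂ν ≤ r n)
    (hR : Tendsto r atTop (𝓝 R)) : Integrable f ν ∧ ∫ x, f x ∂ν ≤ R := by
  have hf_nonneg : ∀ x, 0 ≤ f x := fun x => ge_of_tendsto' (hlim x) fun n => hF_nonneg n x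
  have hR_nonneg : 0 ≤ R :=
    ge_of_tendsto' hR fun n => (integral_nonneg (hF_nonneg n)).trans (hr n)
  have key : ∫⁻ x, ENNReal.ofReal (f x) ∂ν ≤ ENNReal.ofReal R := by
    calc ∫⁻ x, ENNReal.ofReal (f x) ∂ν
        = ∫⁻ x, liminf (fun n => ENNReal.ofReal (F n x)) atTop ∂ν := by
          congr with x
          exact ((ENNReal.continuous_ofReal.tendsto _).comp (hlim x)).liminf_eq.symm
      _ ≤ liminf (fun n => ∫⁻ x, ENNReal.ofReal (F n x) ∂ν) atTop :=
          lintegral_liminf_le' fun n => (hF n).aestronglyMeasurable.aemeasurable.ennreal_ofReal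
      _ ≤ liminf (fun n => ENNReal.ofReal (r n)) atTop := by
          refine liminf_le_liminf (Eventually.of_forall fun n => ?_)
          rw [← ofReal_integral_eq_lintegral_ofReal (hF n) (ae_of_all _ (hF_nonneg n))]
          exact ENNReal.ofReal_le_ofReal (hr n)
      _ = ENNReal.ofReal R := ((ENNReal.continuous_ofReal.tendsto _).comp hR).liminf_eq
  have hfi : Integrable f ν := by
    rw [← lintegral_ofReal_ne_top_iff_integrable hf (ae_of_all _ hf_nonneg)]
    exact ne_top_of_le_ne_top ENNReal.ofReal_ne_top key
  refine ⟨hfi, ?_⟩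
  rw [← ofReal_integral_eq_lintegral_ofReal hfi (ae_of_all _ hf_nonneg)] at key
  exact (ENNReal.ofReal_le_ofReal_iff hR_nonneg).1 key

theorem TameLSIWith.satisfiesLSI {ν : Measure (EuclideanSpace ℝ (Fin d))}
    [IsProbabilityMeasure ν] {C : ℝ≥0} (hν : TameLSIWith ν C) : SatisfiesLSI ν C := by
  intro f hf hfL hgL
  obtain ⟨χ, B, hχ, hχs, hχ1, hχd, hχe⟩ := exists_cutoff (EuclideanSpace ℝ (Fin d))
  have hgrad : ∀ x, ‖gradient f x‖ = ‖fderiv ℝ f x‖ := fun x => by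
    rw [gradient, LinearIsometryEquiv.norm_map]
  simp_rw [hgrad]
  have hf2 : Integrable (fun x => f x ^ 2) ν := hfL.integrable_sq
  have hD2 : Integrable (fun x => ‖fderiv ℝ f x‖ ^ 2) ν := by
    have := hgL.norm.integrable_sq
    simpa only [hgrad] using this
  have hε : ∀ n : ℕ, (0 : ℝ) < 1 / ((n : ℝ) + 1) := fun n => Nat.one_div_pos_of_nat
  have hε1 : ∀ n : ℕ, 1 / ((n : ℝ) + 1) ≤ 1 := fun n => by
    rw [div_le_one (by positivity)]
    linarith [(Nat.cast_nonneg n : (0 : ℝ) ≤ n)]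
  have hε0 : Tendsto (fun n : ℕ => 1 / ((n : ℝ) + 1)) atTop (𝓝 0) :=
    tendsto_one_div_add_atTop_nhds_zero_nat
  have hB : 0 ≤ B := by
    have := (norm_nonneg _).trans (hχd 0 0)
    simpa using this
  -- Test functions are `g_n² + 1 / (n+1)` with `g_n` the cutoff of `f`: the shift keeps them away
  -- from zero and both modifications disappear in the limit.
  set g : ℕ → EuclideanSpace ℝ (Fin d) → ℝ := fun n x => χ n x * f x with hg
  have hgc : ∀ n, ContDiff ℝ 1 (g n) := fun n => (hχ n).mul hf
  have hgs : ∀ n, HasCompactSupport (g n) := fun n => (hχs n).mul_right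
  have hgd : ∀ n x, fderiv ℝ (g n) x = χ n x • fderiv ℝ f x + f x • fderiv ℝ (χ n) x := fun n x =>
    fderiv_fun_mul ((hχ n).differentiable one_ne_zero x) (hf.differentiable one_ne_zero x)
  have hu_lim : ∀ x, Tendsto (fun n => g n x ^ 2 + 1 / ((n : ℝ) + 1)) atTop (𝓝 (f x ^ 2)) := by
    intro x
    have h1 : Tendsto (fun n : ℕ => f x ^ 2 + 1 / ((n : ℝ) + 1)) atTop (𝓝 (f x ^ 2 + 0)) :=
      tendsto_const_nhds.add hε0
    rw [add_zero] at h1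
    refine h1.congr' ?_
    filter_upwards [hχe x] with n hn
    simp [hg, hn]
  have hd_lim : ∀ x, Tendsto (fun n => ‖fderiv ℝ (g n) x‖ ^ 2) atTop (𝓝 (‖fderiv ℝ f x‖ ^ 2)) := by
    intro x
    have h0 : Tendsto (fun n => f x • fderiv ℝ (χ n) x) atTop (𝓝 0) := by
      refine squeeze_zero_norm (a := fun n : ℕ => |f x| * (B * (1 / ((n : ℝ) + 1))))
        (fun n => ?_) ?_
      · rw [norm_smul, Real.norm_eq_abs]
        exact mul_le_mul_of_nonneg_left (hχd n x) (abs_nonneg _)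
      · simpa using (hε0.const_mul B).const_mul |f x|
    have h1 : Tendsto (fun n => fderiv ℝ f x + f x • fderiv ℝ (χ n) x) atTop
        (𝓝 (fderiv ℝ f x + 0)) := tendsto_const_nhds.add h0
    rw [add_zero] at h1
    refine ((h1.congr' ?_).norm).pow 2
    filter_upwards [hχe x] with n hn
    rw [hgd, hn, one_smul]
  have hg_le : ∀ n x, g n x ^ 2 ≤ f x ^ 2 := by
    intro n x
    rw [hg, mul_pow]
    exact mul_le_of_le_one_left (sq_nonneg _) ((sq_le_one_iff_abs_le_one _).2 (hχ1 n x))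
  have hm_lim : Tendsto (fun n => ∫ x, (g n x ^ 2 + 1 / ((n : ℝ) + 1)) ∂ν) atTop
      (𝓝 (∫ x, f x ^ 2 ∂ν)) := by
    refine tendsto_integral_of_dominated_convergence (fun x => f x ^ 2 + 1)
      (fun n => (((hgc n).continuous.pow 2).add continuous_const).aestronglyMeasurable)
      (hf2.add (integrable_const 1)) (fun n => ae_of_all _ fun x => ?_) (ae_of_all _ hu_lim)
    have := (hε n).le
    rw [Real.norm_of_nonneg (by positivity)]
    exact add_le_add (hg_le n x) (hε1 n)
  have hD_lim : Tendsto (fun n => ∫ x, ‖fderiv ℝ (g n) x‖ ^ 2 ∂ν) atTop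
      (𝓝 (∫ x, ‖fderiv ℝ f x‖ ^ 2 ∂ν)) := by
    -- The product rule and `(a + b)² ≤ 2 a² + 2 b²` give the dominating function, integrable since
    -- `f` and its gradient are in `L²`.
    refine tendsto_integral_of_dominated_convergence
      (fun x => 2 * ‖fderiv ℝ f x‖ ^ 2 + 2 * B ^ 2 * f x ^ 2)
      (fun n => (((hgc n).continuous_fderiv one_ne_zero).norm.pow 2).aestronglyMeasurable)
      ((hD2.const_mul 2).add (hf2.const_mul (2 * B ^ 2))) (fun n => ae_of_all _ fun x => ?_)
      (ae_of_all _ hd_lim)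
    rw [Real.norm_of_nonneg (by positivity)]
    have h1 : ‖fderiv ℝ (g n) x‖ ≤ ‖fderiv ℝ f x‖ + |f x| * B := by
      rw [hgd]
      refine (norm_add_le _ _).trans (add_le_add ?_ ?_)
      · rw [norm_smul, Real.norm_eq_abs]
        exact mul_le_of_le_one_left (norm_nonneg _) (hχ1 n x)
      · rw [norm_smul, Real.norm_eq_abs]
        refine mul_le_mul_of_nonneg_left ((hχd n x).trans ?_) (abs_nonneg _)
        exact mul_le_of_le_one_right hB (hε1 n)
    have h2 := pow_le_pow_left₀ (norm_nonneg _) h1 2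
    have h3 : (|f x| * B) ^ 2 = B ^ 2 * f x ^ 2 := by rw [mul_pow, sq_abs, mul_comm]
    nlinarith [sq_nonneg (‖fderiv ℝ f x‖ - |f x| * B)]
  -- Adding `1` makes the integrand nonnegative, because `t log t ≥ t - 1`. Nothing dominates `f²
  -- log f²` a priori; Fatou delivers its integrability together with the bound.
  have hfatou := integrable_and_integral_le_of_tendsto (ν := ν)
    (F := fun n x => (g n x ^ 2 + 1 / ((n : ℝ) + 1)) * Real.log (g n x ^ 2 + 1 / ((n : ℝ) + 1)) + 1)
    (f := fun x => f x ^ 2 * Real.log (f x ^ 2) + 1)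
    (r := fun n => (∫ x, (g n x ^ 2 + 1 / ((n : ℝ) + 1)) ∂ν) *
      Real.log (∫ x, (g n x ^ 2 + 1 / ((n : ℝ) + 1)) ∂ν) +
        2 * C * ∫ x, ‖fderiv ℝ (g n) x‖ ^ 2 ∂ν + 1)
    (R := (∫ x, f x ^ 2 ∂ν) * Real.log (∫ x, f x ^ 2 ∂ν) +
      2 * C * ∫ x, ‖fderiv ℝ f x‖ ^ 2 ∂ν + 1)
    (fun n => (isTame_sq_add (hgc n) (hgs n) (hε n)).integrable_mul_log.add (integrable_const 1))
    (fun n x => ?_)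
    ((Real.continuous_mul_log.comp (hf.continuous.pow 2)).add
      continuous_const).aestronglyMeasurable
    (fun x => ((Real.continuous_mul_log.tendsto _).comp (hu_lim x)).add_const 1)
    (fun n => ?_)
    ((((Real.continuous_mul_log.tendsto _).comp hm_lim).add (hD_lim.const_mul (2 * (C : ℝ)))).add_const 1)
  · have hint : Integrable (fun x => f x ^ 2 * Real.log (f x ^ 2)) ν := by
      exact (hfatou.1.sub (integrable_const 1)).congr (ae_of_all _ fun x => add_sub_cancel_right _ _)
    refine ⟨hint, ?_⟩
    have h := hfatou.2
    rw [integral_add hint (integrable_const 1)] at h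
    simp only [integral_const, probReal_univ, smul_eq_mul, mul_one] at h
    unfold entropy
    linarith
  · have hpos : 0 < g n x ^ 2 + 1 / ((n : ℝ) + 1) := add_pos_of_nonneg_of_pos (sq_nonneg _) (hε n)
    have h1 := Real.one_sub_inv_le_log_of_pos hpos
    have h2 := mul_le_mul_of_nonneg_left h1 hpos.le
    rw [mul_sub, mul_inv_cancel₀ hpos.ne'] at h2
    linarith
  · rw [integral_add (isTame_sq_add (hgc n) (hgs n) (hε n)).integrable_mul_log (integrable_const 1)]
    have h := hν.entropy_sq_le C.coe_nonneg (hgc n) (hgs n) (hε n)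
    simp only [integral_const, probReal_univ, smul_eq_mul, mul_one]
    linarith

end

/-! ### Measures with densities proportional to a given function -/

section Proportional

variable {d : ℕ} {f : EuclideanSpace ℝ (Fin d) → ℝ}

theorem integral_pos_of_forall_pos (hf_pos : ∀ x, 0 < f x)
    (hfi : Integrable f) : 0 < ∫ x, f x := by
  rw [integral_pos_iff_support_of_nonneg (fun x => (hf_pos x).le) hfi]
  have : Function.support f = univ := Function.support_eq_univ fun x => (hf_pos x).ne'
  rw [this]
  exact isOpen_univ.measure_pos _ univ_nonempty

theorem measureProportionalTo_eq_withDensity (hf : Continuous f) (hf_pos : ∀ x, 0 < f x)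
    (hfi : Integrable f) :
    measureProportionalTo f = volume.withDensity fun x => ENNReal.ofReal (f x / ∫ y, f y) := by
  have hI := integral_pos_of_forall_pos hf_pos hfi
  rw [measureProportionalTo,
    ← ofReal_integral_eq_lintegral_ofReal hfi (ae_of_all _ fun x => (hf_pos x).le),
    ← ENNReal.ofReal_inv_of_pos hI, ← withDensity_smul _ hf.measurable.ennreal_ofReal]
  congr with x
  rw [Pi.smul_apply, smul_eq_mul, ← ENNReal.ofReal_mul (inv_pos.2 hI).le, div_eq_inv_mul]

theorem isProbabilityMeasure_measureProportionalTo (hf : Continuous f) (hf_pos : ∀ x, 0 < f x)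
    (hfi : Integrable f) : IsProbabilityMeasure (measureProportionalTo f) := by
  have hI := integral_pos_of_forall_pos hf_pos hfi
  constructor
  rw [measureProportionalTo_eq_withDensity hf hf_pos hfi, withDensity_apply _ .univ,
    Measure.restrict_univ, ← ofReal_integral_eq_lintegral_ofReal (hfi.div_const _)
      (ae_of_all _ fun x => (div_pos (hf_pos x) hI).le), integral_div, div_self hI.ne',
    ENNReal.ofReal_one]

end Proportional

/-! ### Tempered Gaussian mixtures -/

section Mixture

variable {d M : ℕ} {α : Fin M → ℝ} (m : Fin M → EuclideanSpace ℝ (Fin d))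
  {S : Fin M → Matrix (Fin d) (Fin d) ℝ} {b : ℝ}

theorem nonempty_of_sum_eq_one (hα_sum : ∑ k, α k = 1) : Nonempty (Fin M) := by
  by_contra h
  rw [not_nonempty_iff] at h
  simp at hα_sum

theorem iInf_pos_of_pos {ι : Type*} [Finite ι] [Nonempty ι] {f : ι → ℝ} (hf : ∀ i, 0 < f i) :
    0 < ⨅ i, f i := by
  obtain ⟨i, hi⟩ := exists_eq_ciInf_of_finite (f := f)
  exact hi ▸ hf i

theorem iInf_le_of_finite {ι : Type*} [Finite ι] (f : ι → ℝ) (i : ι) : ⨅ i, f i ≤ f i :=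
  ciInf_le (Set.finite_range f).bddBelow i

theorem le_iSup_of_finite {ι : Type*} [Finite ι] (f : ι → ℝ) (i : ι) : f i ≤ ⨆ i, f i :=
  le_ciSup (Set.finite_range f).bddAbove i

theorem continuous_mixtureDensity (α : Fin M → ℝ) (S : Fin M → Matrix (Fin d) (Fin d) ℝ) :
    Continuous (mixtureDensity α m S) :=
  continuous_finsetSum _ fun k _ => continuous_const.mul (continuous_gaussianDensity (m k) (S k))

theorem mixtureDensity_pos (hα : ∀ k, 0 < α k) (hα_sum : ∑ k, α k = 1)
    (hS : ∀ k, (S k).PosDef) (x : EuclideanSpace ℝ (Fin d)) : 0 < mixtureDensity α m S x := by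
  have := nonempty_of_sum_eq_one hα_sum
  exact Finset.sum_pos (fun k _ => mul_pos (hα k) (gaussianDensity_pos (m k) (hS k) x))
    Finset.univ_nonempty

/-! ### Comparison of the tempered mixture with the mixture of powers -/

/-- The mixture `∑ k, α k * q(x; m k, S k) ^ b` of the powers of the components. -/
noncomputable def powMixture (α : Fin M → ℝ) (m : Fin M → EuclideanSpace ℝ (Fin d))
    (S : Fin M → Matrix (Fin d) (Fin d) ℝ) (b : ℝ) (x : EuclideanSpace ℝ (Fin d)) : ℝ :=
  ∑ j, α j * gaussianDensity (m j) (S j) x ^ b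

theorem continuous_powMixture (α : Fin M → ℝ) (hS : ∀ k, (S k).PosDef) (b : ℝ) :
    Continuous (powMixture α m S b) :=
  continuous_finsetSum _ fun k _ =>
    continuous_const.mul (continuous_gaussianDensity_rpow (m k) (hS k) b)

theorem powMixture_pos (hα : ∀ k, 0 < α k) (hα_sum : ∑ k, α k = 1) (hS : ∀ k, (S k).PosDef)
    (b : ℝ) (x : EuclideanSpace ℝ (Fin d)) : 0 < powMixture α m S b x := by
  have := nonempty_of_sum_eq_one hα_sum
  exact Finset.sum_pos (fun k _ => mul_pos (hα k)
    (Real.rpow_pos_of_pos (gaussianDensity_pos (m k) (hS k) x) b)) Finset.univ_nonempty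

theorem integrable_powMixture (α : Fin M → ℝ) (hS : ∀ k, (S k).PosDef) (hb : 0 < b) :
    Integrable (powMixture α m S b) :=
  integrable_finsetSum _ fun k _ =>
    (integrable_gaussianDensity_rpow (m k) (hS k) hb).const_mul (α k)

theorem integral_powMixture (α : Fin M → ℝ) (hS : ∀ k, (S k).PosDef) (hb : 0 < b) :
    ∫ x, powMixture α m S b x = ∑ k, α k * gaussianPowIntegral (S k) b := by
  unfold powMixture
  rw [integral_finsetSum _ fun k _ =>
    (integrable_gaussianDensity_rpow (m k) (hS k) hb).const_mul (α k)]
  refine Finset.sum_congr rfl fun k _ => ?_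
  rw [integral_const_mul, integral_gaussianDensity_rpow (m k) (hS k) hb]

/-- Jensen's inequality for the concave function `t ^ b` with weights `α`; this is where `b ≤ 1`
matters. -/
theorem powMixture_le_mixtureDensity_rpow (hα : ∀ k, 0 < α k) (hα_sum : ∑ k, α k = 1)
    (hS : ∀ k, (S k).PosDef) (hb : 0 < b) (hb1 : b ≤ 1) (x : EuclideanSpace ℝ (Fin d)) :
    powMixture α m S b x ≤ mixtureDensity α m S x ^ b := by
  have := (Real.concaveOn_rpow hb.le hb1).le_map_sum (t := Finset.univ) (w := α)
    (p := fun k => gaussianDensity (m k) (S k) x) (fun k _ => (hα k).le) hα_sum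
    fun k _ => (gaussianDensity_pos (m k) (hS k) x).le
  simp only [smul_eq_mul] at this
  exact this

/-- At each point the average is at most the largest component, whose power already appears in the
sum with weight at least `min α`. -/
theorem mixtureDensity_rpow_le_powMixture (hα : ∀ k, 0 < α k) (hα_sum : ∑ k, α k = 1)
    (hS : ∀ k, (S k).PosDef) (hb : 0 < b) (x : EuclideanSpace ℝ (Fin d)) :
    mixtureDensity α m S x ^ b ≤ 1 / (⨅ k, α k) * powMixture α m S b x := by
  have := nonempty_of_sum_eq_one hα_sum
  have ha := iInf_pos_of_pos hα
  obtain ⟨k, hk⟩ := Finite.exists_max fun k => gaussianDensity (m k) (S k) x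
  have hq := gaussianDensity_pos (m k) (hS k) x
  have h1 : mixtureDensity α m S x ≤ gaussianDensity (m k) (S k) x := by
    calc mixtureDensity α m S x ≤ ∑ j, α j * gaussianDensity (m k) (S k) x :=
          Finset.sum_le_sum fun j _ => mul_le_mul_of_nonneg_left (hk j) (hα j).le
      _ = _ := by rw [← Finset.sum_mul, hα_sum, one_mul]
  have h2 : α k * gaussianDensity (m k) (S k) x ^ b ≤ powMixture α m S b x :=
    Finset.single_le_sum (f := fun j => α j * gaussianDensity (m j) (S j) x ^ b)
      (fun j _ => mul_nonneg (hα j).le (Real.rpow_nonneg (gaussianDensity_pos _ (hS j) x).le _))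
      (Finset.mem_univ k)
  rw [one_div, ← div_eq_inv_mul, le_div_iff₀ ha]
  calc mixtureDensity α m S x ^ b * (⨅ k, α k)
      ≤ gaussianDensity (m k) (S k) x ^ b * α k :=
        mul_le_mul (Real.rpow_le_rpow (mixtureDensity_pos m hα hα_sum hS x).le h1 hb.le)
          (iInf_le_of_finite α k) ha.le (Real.rpow_nonneg hq.le _)
    _ ≤ _ := by rwa [mul_comm]

theorem continuous_mixtureDensity_rpow (hα : ∀ k, 0 < α k) (hα_sum : ∑ k, α k = 1)
    (hS : ∀ k, (S k).PosDef) (b : ℝ) : Continuous fun x => mixtureDensity α m S x ^ b :=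
  (continuous_mixtureDensity m α S).rpow_const fun x =>
    .inl (mixtureDensity_pos m hα hα_sum hS x).ne'

theorem integrable_mixtureDensity_rpow (hα : ∀ k, 0 < α k) (hα_sum : ∑ k, α k = 1)
    (hS : ∀ k, (S k).PosDef) (hb : 0 < b) :
    Integrable fun x => mixtureDensity α m S x ^ b := by
  refine ((integrable_powMixture m α hS hb).const_mul (1 / (⨅ k, α k))).mono'
    (continuous_mixtureDensity_rpow m hα hα_sum hS b).aestronglyMeasurable (ae_of_all _ fun x => ?_)
  rw [Real.norm_of_nonneg (Real.rpow_nonneg (mixtureDensity_pos m hα hα_sum hS x).le _)]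
  exact mixtureDensity_rpow_le_powMixture m hα hα_sum hS hb x

theorem isProbabilityMeasure_temperedMeasure (hα : ∀ k, 0 < α k) (hα_sum : ∑ k, α k = 1)
    (hS : ∀ k, (S k).PosDef) (hb : 0 < b) : IsProbabilityMeasure (temperedMeasure α m S b) :=
  isProbabilityMeasure_measureProportionalTo (continuous_mixtureDensity_rpow m hα hα_sum hS b)
    (fun x => Real.rpow_pos_of_pos (mixtureDensity_pos m hα hα_sum hS x) b)
    (integrable_mixtureDensity_rpow m hα hα_sum hS hb)

/-! ### The density ratio -/

/-- Isolates the dependence on the exponent: the width of the Gaussian gives `(c / b) ^ (d / 2)`,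
the prefactor a power `c - b`. -/
theorem gaussianPowIntegral_eq_mul {S : Matrix (Fin d) (Fin d) ℝ} (hS : S.PosDef) {b c : ℝ}
    (hb : 0 < b) (hc : 0 < c) :
    gaussianPowIntegral S b = ((2 * Real.pi) ^ ((d : ℝ) / 2) * √S.det) ^ (c - b) *
      (c / b) ^ ((d : ℝ) / 2) * gaussianPowIntegral S c := by
  have hdet := hS.det_pos
  have hpi := Real.pi_pos
  unfold gaussianPowIntegral
  set N := (2 * Real.pi) ^ ((d : ℝ) / 2) * √S.det with hN
  have hN_pos : 0 < N := by positivity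
  have h1 : 2 * Real.pi / b = c / b * (2 * Real.pi / c) := by field_simp
  rw [h1, Real.mul_rpow (by positivity) (by positivity), Real.inv_rpow hN_pos.le,
    Real.inv_rpow hN_pos.le, Real.rpow_sub hN_pos]
  have := (Real.rpow_pos_of_pos hN_pos b).ne'
  have := (Real.rpow_pos_of_pos hN_pos c).ne'
  field_simp

theorem mixtureDensity_le (hα : ∀ k, 0 < α k) (hα_sum : ∑ k, α k = 1)
    (hS : ∀ k, (S k).PosDef) (x : EuclideanSpace ℝ (Fin d)) :
    mixtureDensity α m S x ≤ ((2 * Real.pi) ^ ((d : ℝ) / 2) * √(⨅ k, (S k).det))⁻¹ := by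
  have := nonempty_of_sum_eq_one hα_sum
  have hpi := Real.pi_pos
  have hdet : 0 < ⨅ k, (S k).det := iInf_pos_of_pos fun k => (hS k).det_pos
  rw [← one_mul (_⁻¹), ← hα_sum, Finset.sum_mul]
  refine Finset.sum_le_sum fun k _ => mul_le_mul_of_nonneg_left
    ((gaussianDensity_le (m k) (hS k) x).trans ?_) (hα k).le
  gcongr
  exact iInf_le_of_finite (fun k => (S k).det) k

/-- Pass to the mixture of powers at exponent `b`, compare Gaussian integrals term by term, and
return at exponent `c`. Only the first passage costs `1 / min α`; the return is Jensen. -/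
theorem integral_mixtureDensity_rpow_le (hα : ∀ k, 0 < α k) (hα_sum : ∑ k, α k = 1)
    (hS : ∀ k, (S k).PosDef) {b c : ℝ} (hb : 0 < b) (hbc : b ≤ c) (hc : c ≤ 1) :
    ∫ x, mixtureDensity α m S x ^ b ≤ 1 / (⨅ k, α k) * (c / b) ^ ((d : ℝ) / 2) *
      ((2 * Real.pi) ^ ((d : ℝ) / 2) * √(⨆ k, (S k).det)) ^ (c - b) *
        ∫ x, mixtureDensity α m S x ^ c := by
  have := nonempty_of_sum_eq_one hα_sum
  have hpi := Real.pi_pos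
  have ha := iInf_pos_of_pos hα
  have hc0 : 0 < c := hb.trans_le hbc
  have h1 : ∫ x, mixtureDensity α m S x ^ b ≤ 1 / (⨅ k, α k) * ∫ x, powMixture α m S b x := by
    rw [← integral_const_mul]
    exact integral_mono (integrable_mixtureDensity_rpow m hα hα_sum hS hb)
      ((integrable_powMixture m α hS hb).const_mul _)
      (mixtureDensity_rpow_le_powMixture m hα hα_sum hS hb)
  have h2 : ∫ x, powMixture α m S c x ≤ ∫ x, mixtureDensity α m S x ^ c :=
    integral_mono (integrable_powMixture m α hS hc0)
      (integrable_mixtureDensity_rpow m hα hα_sum hS hc0)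
      (powMixture_le_mixtureDensity_rpow m hα hα_sum hS hc0 hc)
  have h3 : ∫ x, powMixture α m S b x ≤
      ((2 * Real.pi) ^ ((d : ℝ) / 2) * √(⨆ k, (S k).det)) ^ (c - b) * (c / b) ^ ((d : ℝ) / 2) *
        ∫ x, powMixture α m S c x := by
    rw [integral_powMixture m α hS hb, integral_powMixture m α hS hc0, Finset.mul_sum]
    refine Finset.sum_le_sum fun k _ => ?_
    rw [mul_left_comm]
    refine mul_le_mul_of_nonneg_left ?_ (hα k).le
    rw [gaussianPowIntegral_eq_mul (hS k) hb hc0]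
    have := (gaussianPowIntegral_pos (hS k) hc0).le
    have := (hS k).det_pos
    have hle : (S k).det ≤ ⨆ k, (S k).det := le_iSup_of_finite (fun k => (S k).det) k
    have hbc' : 0 ≤ c - b := sub_nonneg.2 hbc
    gcongr
  calc _ ≤ 1 / (⨅ k, α k) * (((2 * Real.pi) ^ ((d : ℝ) / 2) * √(⨆ k, (S k).det)) ^ (c - b) *
        (c / b) ^ ((d : ℝ) / 2) * ∫ x, mixtureDensity α m S x ^ c) := by
        refine h1.trans (mul_le_mul_of_nonneg_left (h3.trans ?_) (by positivity))
        gcongr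
    _ = _ := by ring

theorem mixtureDensity_rpow_sub_mul_le (hα : ∀ k, 0 < α k) (hα_sum : ∑ k, α k = 1)
    (hS : ∀ k, (S k).PosDef) {b c : ℝ} (hb : 0 < b) (hbc : b ≤ c) (hc : c ≤ 1)
    (x : EuclideanSpace ℝ (Fin d)) :
    mixtureDensity α m S x ^ (c - b) * ((∫ y, mixtureDensity α m S y ^ b) /
        ∫ y, mixtureDensity α m S y ^ c) ≤
      1 / (⨅ k, α k) * (c / b) ^ ((d : ℝ) / 2) *
        ((⨆ k, (S k).det) / (⨅ k, (S k).det)) ^ ((c - b) / 2) := by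
  have := nonempty_of_sum_eq_one hα_sum
  have hpi := Real.pi_pos
  have ha := iInf_pos_of_pos hα
  have hc0 : 0 < c := hb.trans_le hbc
  have hmin : 0 < ⨅ k, (S k).det := iInf_pos_of_pos fun k => (hS k).det_pos
  obtain ⟨k₀⟩ := id this
  have hmax : 0 < ⨆ k, (S k).det :=
    (hS k₀).det_pos.trans_le (le_iSup_of_finite (fun k => (S k).det) k₀)
  have hI : 0 < ∫ y, mixtureDensity α m S y ^ c := integral_pos_of_forall_pos
    (fun x => Real.rpow_pos_of_pos (mixtureDensity_pos m hα hα_sum hS x) c)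
    (integrable_mixtureDensity_rpow m hα hα_sum hS hc0)
  set P := (2 * Real.pi) ^ ((d : ℝ) / 2) with hP
  have hP_pos : 0 < P := by positivity
  have h1 : (∫ y, mixtureDensity α m S y ^ b) / ∫ y, mixtureDensity α m S y ^ c ≤
      1 / (⨅ k, α k) * (c / b) ^ ((d : ℝ) / 2) * (P * √(⨆ k, (S k).det)) ^ (c - b) := by
    rw [div_le_iff₀ hI]
    exact integral_mixtureDensity_rpow_le m hα hα_sum hS hb hbc hc
  have h2 : mixtureDensity α m S x ^ (c - b) ≤ (P * √(⨅ k, (S k).det))⁻¹ ^ (c - b) :=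
    Real.rpow_le_rpow (mixtureDensity_pos m hα hα_sum hS x).le
      (mixtureDensity_le m hα hα_sum hS x) (by linarith)
  -- The sup bound on the density and the integral bound carry the same power `c - b`, so `P`
  -- cancels and only the determinants remain.
  have h3 : (P * √(⨅ k, (S k).det))⁻¹ ^ (c - b) * (P * √(⨆ k, (S k).det)) ^ (c - b) =
      ((⨆ k, (S k).det) / (⨅ k, (S k).det)) ^ ((c - b) / 2) := by
    have h : (P * √(⨅ k, (S k).det))⁻¹ * (P * √(⨆ k, (S k).det)) =
        ((⨆ k, (S k).det) / (⨅ k, (S k).det)) ^ (1 / 2 : ℝ) := by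
      rw [← Real.sqrt_eq_rpow, Real.sqrt_div hmax.le]
      field_simp
    rw [← Real.mul_rpow (by positivity) (by positivity), h, ← Real.rpow_mul (by positivity)]
    congr 1
    ring
  calc _ ≤ (P * √(⨅ k, (S k).det))⁻¹ ^ (c - b) *
        (1 / (⨅ k, α k) * (c / b) ^ ((d : ℝ) / 2) * (P * √(⨆ k, (S k).det)) ^ (c - b)) :=
        mul_le_mul h2 h1 (div_nonneg (integral_nonneg fun y =>
          Real.rpow_nonneg (mixtureDensity_pos m hα hα_sum hS y).le _) hI.le) (by positivity)
    _ = _ := by rw [← h3]; ring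

theorem temperedMeasure_eq_withDensity (hα : ∀ k, 0 < α k) (hα_sum : ∑ k, α k = 1)
    (hS : ∀ k, (S k).PosDef) (hb : 0 < b) :
    temperedMeasure α m S b = volume.withDensity fun x =>
      ENNReal.ofReal (mixtureDensity α m S x ^ b / ∫ y, mixtureDensity α m S y ^ b) :=
  measureProportionalTo_eq_withDensity (continuous_mixtureDensity_rpow m hα hα_sum hS b)
    (fun x => Real.rpow_pos_of_pos (mixtureDensity_pos m hα hα_sum hS x) b)
    (integrable_mixtureDensity_rpow m hα hα_sum hS hb)

theorem temperedMeasure_eq_withDensity_temperedMeasure (hα : ∀ k, 0 < α k)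
    (hα_sum : ∑ k, α k = 1) (hS : ∀ k, (S k).PosDef) {b c : ℝ} (hb : 0 < b) (hc : 0 < c) :
    temperedMeasure α m S c = (temperedMeasure α m S b).withDensity fun x =>
      ENNReal.ofReal (mixtureDensity α m S x ^ (c - b) * ((∫ y, mixtureDensity α m S y ^ b) /
        ∫ y, mixtureDensity α m S y ^ c)) := by
  have hpos := mixtureDensity_pos m hα hα_sum hS
  have hI : ∀ e : ℝ, 0 < e → 0 < ∫ y, mixtureDensity α m S y ^ e := fun e he =>
    integral_pos_of_forall_pos
      (fun x => Real.rpow_pos_of_pos (hpos x) _) (integrable_mixtureDensity_rpow m hα hα_sum hS he)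
  rw [temperedMeasure_eq_withDensity m hα hα_sum hS hb,
    temperedMeasure_eq_withDensity m hα hα_sum hS hc, ← withDensity_mul]
  · congr with x
    have h1 := hI b hb
    have h2 := hI c hc
    have h3 := Real.rpow_pos_of_pos (hpos x) b
    rw [Pi.mul_apply, ← ENNReal.ofReal_mul (div_pos h3 h1).le, Real.rpow_sub (hpos x)]
    congr 1
    generalize (∫ y, mixtureDensity α m S y ^ b) = I at h1 ⊢
    generalize (∫ y, mixtureDensity α m S y ^ c) = J at h2 ⊢
    field_simp
  · exact ((continuous_mixtureDensity_rpow m hα hα_sum hS b).div_const _).measurable.ennreal_ofReal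
  · exact ((continuous_mixtureDensity_rpow m hα hα_sum hS _).mul_const _).measurable.ennreal_ofReal

/-! ### The components -/

theorem componentDensity_eq (α : Fin M → ℝ) (S : Fin M → Matrix (Fin d) (Fin d) ℝ) (b : ℝ)
    (k : Fin M) (x : EuclideanSpace ℝ (Fin d)) :
    componentDensity α m S b k x =
      mixtureDensity α m S x ^ b / powMixture α m S b x * gaussianDensity (m k) (S k) x ^ b := rfl

theorem one_le_mixtureDensity_rpow_div (hα : ∀ k, 0 < α k) (hα_sum : ∑ k, α k = 1)
    (hS : ∀ k, (S k).PosDef) (hb : 0 < b) (hb1 : b ≤ 1) (x : EuclideanSpace ℝ (Fin d)) :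
    1 ≤ mixtureDensity α m S x ^ b / powMixture α m S b x := by
  rw [one_le_div (powMixture_pos m hα hα_sum hS b x)]
  exact powMixture_le_mixtureDensity_rpow m hα hα_sum hS hb hb1 x

theorem mixtureDensity_rpow_div_le (hα : ∀ k, 0 < α k) (hα_sum : ∑ k, α k = 1)
    (hS : ∀ k, (S k).PosDef) (hb : 0 < b) (x : EuclideanSpace ℝ (Fin d)) :
    mixtureDensity α m S x ^ b / powMixture α m S b x ≤ 1 / (⨅ k, α k) := by
  rw [div_le_iff₀ (powMixture_pos m hα hα_sum hS b x)]
  exact mixtureDensity_rpow_le_powMixture m hα hα_sum hS hb x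

theorem continuous_mixtureDensity_rpow_div (hα : ∀ k, 0 < α k) (hα_sum : ∑ k, α k = 1)
    (hS : ∀ k, (S k).PosDef) (b : ℝ) :
    Continuous fun x => mixtureDensity α m S x ^ b / powMixture α m S b x :=
  (continuous_mixtureDensity_rpow m hα hα_sum hS b).div (continuous_powMixture m α hS b)
    fun x => (powMixture_pos m hα hα_sum hS b x).ne'

theorem continuous_componentDensity (hα : ∀ k, 0 < α k) (hα_sum : ∑ k, α k = 1)
    (hS : ∀ k, (S k).PosDef) (b : ℝ) (k : Fin M) : Continuous (componentDensity α m S b k) :=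
  (continuous_mixtureDensity_rpow_div m hα hα_sum hS b).mul
    (continuous_gaussianDensity_rpow (m k) (hS k) b)

theorem componentDensity_pos (hα : ∀ k, 0 < α k) (hα_sum : ∑ k, α k = 1)
    (hS : ∀ k, (S k).PosDef) (b : ℝ) (k : Fin M) (x : EuclideanSpace ℝ (Fin d)) :
    0 < componentDensity α m S b k x :=
  mul_pos (div_pos (Real.rpow_pos_of_pos (mixtureDensity_pos m hα hα_sum hS x) b)
    (powMixture_pos m hα hα_sum hS b x))
    (Real.rpow_pos_of_pos (gaussianDensity_pos (m k) (hS k) x) b)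

theorem componentDensity_le (hα : ∀ k, 0 < α k) (hα_sum : ∑ k, α k = 1)
    (hS : ∀ k, (S k).PosDef) (hb : 0 < b) (k : Fin M) (x : EuclideanSpace ℝ (Fin d)) :
    componentDensity α m S b k x ≤ 1 / (⨅ k, α k) * gaussianDensity (m k) (S k) x ^ b :=
  mul_le_mul_of_nonneg_right (mixtureDensity_rpow_div_le m hα hα_sum hS hb x)
    (Real.rpow_nonneg (gaussianDensity_pos (m k) (hS k) x).le b)

theorem le_componentDensity (hα : ∀ k, 0 < α k) (hα_sum : ∑ k, α k = 1)
    (hS : ∀ k, (S k).PosDef) (hb : 0 < b) (hb1 : b ≤ 1) (k : Fin M)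
    (x : EuclideanSpace ℝ (Fin d)) :
    gaussianDensity (m k) (S k) x ^ b ≤ componentDensity α m S b k x :=
  le_mul_of_one_le_left (Real.rpow_nonneg (gaussianDensity_pos (m k) (hS k) x).le b)
    (one_le_mixtureDensity_rpow_div m hα hα_sum hS hb hb1 x)

theorem integrable_componentDensity (hα : ∀ k, 0 < α k) (hα_sum : ∑ k, α k = 1)
    (hS : ∀ k, (S k).PosDef) (hb : 0 < b) (k : Fin M) :
    Integrable (componentDensity α m S b k) := by
  refine ((integrable_gaussianDensity_rpow (m k) (hS k) hb).const_mul (1 / (⨅ k, α k))).mono'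
    (continuous_componentDensity m hα hα_sum hS b k).aestronglyMeasurable (ae_of_all _ fun x => ?_)
  rw [Real.norm_of_nonneg (componentDensity_pos m hα hα_sum hS b k x).le]
  exact componentDensity_le m hα hα_sum hS hb k x

theorem integral_componentDensity_pos (hα : ∀ k, 0 < α k) (hα_sum : ∑ k, α k = 1)
    (hS : ∀ k, (S k).PosDef) (hb : 0 < b) (k : Fin M) :
    0 < ∫ x, componentDensity α m S b k x :=
  integral_pos_of_forall_pos
    (componentDensity_pos m hα hα_sum hS b k) (integrable_componentDensity m hα hα_sum hS hb k)

theorem isProbabilityMeasure_componentMeasure (hα : ∀ k, 0 < α k) (hα_sum : ∑ k, α k = 1)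
    (hS : ∀ k, (S k).PosDef) (hb : 0 < b) (k : Fin M) :
    IsProbabilityMeasure (componentMeasure α m S b k) :=
  isProbabilityMeasure_measureProportionalTo (continuous_componentDensity m hα hα_sum hS b k)
    (componentDensity_pos m hα hα_sum hS b k) (integrable_componentDensity m hα hα_sum hS hb k)

theorem componentMeasure_eq_withDensity (hα : ∀ k, 0 < α k) (hα_sum : ∑ k, α k = 1)
    (hS : ∀ k, (S k).PosDef) (hb : 0 < b) (k : Fin M) :
    componentMeasure α m S b k = volume.withDensity fun x =>
      ENNReal.ofReal (componentDensity α m S b k x / ∫ y, componentDensity α m S b k y) :=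
  measureProportionalTo_eq_withDensity (continuous_componentDensity m hα hα_sum hS b k)
    (componentDensity_pos m hα hα_sum hS b k) (integrable_componentDensity m hα hα_sum hS hb k)

/-- Relative to the Gaussian law the density is `π ^ b / p_b` times the ratio `I / Z` of
normalizers. It lies between `I / Z` and `(I / Z) / min α`, so Holley–Stroock costs exactly the
quotient `1 / min α`. -/
theorem tameLSIWith_componentMeasure (hα : ∀ k, 0 < α k) (hα_sum : ∑ k, α k = 1)
    (hS : ∀ k, (S k).PosDef) (hb : 0 < b) (hb1 : b ≤ 1) (k : Fin M) :
    TameLSIWith (componentMeasure α m S b k)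
      (1 / (⨅ j, α j) * ((⨆ l, (hS k).isHermitian.eigenvalues l) / b)) := by
  have := nonempty_of_sum_eq_one hα_sum
  have ha := iInf_pos_of_pos hα
  set Z := ∫ y, componentDensity α m S b k y with hZ
  set I := gaussianPowIntegral (S k) b with hI
  have hZ_pos : 0 < Z := integral_componentDensity_pos m hα hα_sum hS hb k
  have hI_pos : 0 < I := gaussianPowIntegral_pos (hS k) hb
  have hcont : Continuous fun x =>
      mixtureDensity α m S x ^ b / powMixture α m S b x * (I / Z) :=
    (continuous_mixtureDensity_rpow_div m hα hα_sum hS b).mul_const _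
  have heq : componentMeasure α m S b k = (gaussianPowLaw (m k) (S k) b).withDensity fun x =>
      ENNReal.ofReal (mixtureDensity α m S x ^ b / powMixture α m S b x * (I / Z)) := by
    rw [componentMeasure_eq_withDensity m hα hα_sum hS hb k, gaussianPowLaw, ← withDensity_mul]
    · congr with x
      have := gaussianDensity_pos (m k) (hS k) x
      rw [Pi.mul_apply, ← ENNReal.ofReal_mul (by positivity), componentDensity_eq, ← hZ, ← hI]
      congr 1
      field_simp
    · exact ((continuous_gaussianDensity_rpow (m k) (hS k) b).div_const _).measurable.ennreal_ofReal
    · exact hcont.measurable.ennreal_ofReal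
  have hprob := isProbabilityMeasure_componentMeasure m hα hα_sum hS hb k
  rw [heq] at hprob ⊢
  have := isProbabilityMeasure_gaussianPowLaw (m k) (hS k) hb
  have h := (tameLSIWith_gaussianPowLaw (m k) (hS k) hb).withDensity (div_nonneg
    (Real.iSup_nonneg fun i => ((hS k).eigenvalues_pos i).le) hb.le) hcont
    (a := I / Z) (b := 1 / (⨅ j, α j) * (I / Z)) (by positivity)
    (fun x => le_mul_of_one_le_left (by positivity)
      (one_le_mixtureDensity_rpow_div m hα hα_sum hS hb hb1 x))
    (fun x => mul_le_mul_of_nonneg_right (mixtureDensity_rpow_div_le m hα hα_sum hS hb x)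
      (by positivity))
  rwa [mul_div_cancel_right₀ _ (by positivity)] at h

theorem satisfiesLSI_componentMeasure (hα : ∀ k, 0 < α k) (hα_sum : ∑ k, α k = 1)
    (hS : ∀ k, (S k).PosDef) (hb : 0 < b) (hb1 : b ≤ 1) (k : Fin M) :
    SatisfiesLSI (componentMeasure α m S b k)
      (Real.toNNReal (1 / (⨅ j, α j) * ((⨆ l, (hS k).isHermitian.eigenvalues l) / b))) := by
  have := nonempty_of_sum_eq_one hα_sum
  have ha := iInf_pos_of_pos hα
  have := isProbabilityMeasure_componentMeasure m hα hα_sum hS hb k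
  refine TameLSIWith.satisfiesLSI ?_
  rw [Real.coe_toNNReal _ (mul_nonneg (by positivity) (div_nonneg
    (Real.iSup_nonneg fun i => ((hS k).eigenvalues_pos i).le) hb.le))]
  exact tameLSIWith_componentMeasure m hα hα_sum hS hb hb1 k

theorem logSobolevConstant_le {ν : Measure (EuclideanSpace ℝ (Fin d))} {C : ℝ}
    (h : SatisfiesLSI ν C.toNNReal) : logSobolevConstant ν ≤ ENNReal.ofReal C :=
  iInf₂_le C.toNNReal h

/-! ### The weights -/

theorem sum_mul_componentDensity (hα : ∀ k, 0 < α k) (hα_sum : ∑ k, α k = 1)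
    (hS : ∀ k, (S k).PosDef) (b : ℝ) (x : EuclideanSpace ℝ (Fin d)) :
    ∑ k, α k * componentDensity α m S b k x = mixtureDensity α m S x ^ b := by
  simp_rw [componentDensity_eq, mul_left_comm (α _), ← Finset.mul_sum]
  exact div_mul_cancel₀ _ (powMixture_pos m hα hα_sum hS b x).ne'

theorem sum_mul_integral_componentDensity_pos (hα : ∀ k, 0 < α k) (hα_sum : ∑ k, α k = 1)
    (hS : ∀ k, (S k).PosDef) (hb : 0 < b) :
    0 < ∑ j, α j * ∫ x, componentDensity α m S b j x := by
  have := nonempty_of_sum_eq_one hα_sum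
  exact Finset.sum_pos (fun j _ => mul_pos (hα j)
    (integral_componentDensity_pos m hα hα_sum hS hb j)) Finset.univ_nonempty

theorem componentWeight_pos (hα : ∀ k, 0 < α k) (hα_sum : ∑ k, α k = 1)
    (hS : ∀ k, (S k).PosDef) (hb : 0 < b) (k : Fin M) : 0 < componentWeight α m S b k :=
  div_pos (mul_pos (hα k) (integral_componentDensity_pos m hα hα_sum hS hb k))
    (sum_mul_integral_componentDensity_pos m hα hα_sum hS hb)

theorem sum_componentWeight (hα : ∀ k, 0 < α k) (hα_sum : ∑ k, α k = 1)
    (hS : ∀ k, (S k).PosDef) (hb : 0 < b) : ∑ k, componentWeight α m S b k = 1 := by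
  unfold componentWeight
  rw [← Finset.sum_div, div_self (sum_mul_integral_componentDensity_pos m hα hα_sum hS hb).ne']

/-- The weighted unnormalized components add up pointwise to `π ^ b`; the weights are what
normalization of each component leaves over. -/
theorem temperedMeasure_eq_sum (hα : ∀ k, 0 < α k) (hα_sum : ∑ k, α k = 1)
    (hS : ∀ k, (S k).PosDef) (hb : 0 < b) :
    temperedMeasure α m S b =
      ∑ k, ENNReal.ofReal (componentWeight α m S b k) • componentMeasure α m S b k := by
  have hZ := sum_mul_integral_componentDensity_pos m hα hα_sum hS hb
  have hI : ∫ x, mixtureDensity α m S x ^ b = ∑ k, α k * ∫ x, componentDensity α m S b k x := by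
    simp_rw [← sum_mul_componentDensity m hα hα_sum hS b, ← integral_const_mul]
    exact integral_finsetSum _ fun k _ =>
      (integrable_componentDensity m hα hα_sum hS hb k).const_mul _
  ext s hs
  rw [temperedMeasure_eq_withDensity m hα hα_sum hS hb, withDensity_apply _ hs,
    Measure.finsetSum_apply, hI]
  simp_rw [componentMeasure_eq_withDensity m hα hα_sum hS hb, Measure.smul_apply,
    withDensity_apply _ hs, smul_eq_mul]
  have hmeas : ∀ k, Measurable fun x => ENNReal.ofReal
      (componentDensity α m S b k x / ∫ y, componentDensity α m S b k y) := fun k =>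
    ((continuous_componentDensity m hα hα_sum hS b k).div_const _).measurable.ennreal_ofReal
  simp_rw [← lintegral_const_mul _ (hmeas _)]
  rw [← lintegral_finsetSum _ fun k _ => (hmeas k).const_mul _]
  refine lintegral_congr fun x => ?_
  have hw := fun k => (componentWeight_pos m hα hα_sum hS hb k).le
  simp_rw [← ENNReal.ofReal_mul (hw _)]
  rw [← ENNReal.ofReal_sum_of_nonneg fun k _ => mul_nonneg (hw k) (div_nonneg
    (componentDensity_pos m hα hα_sum hS b k x).le
    (integral_componentDensity_pos m hα hα_sum hS hb k).le),
    ← sum_mul_componentDensity m hα hα_sum hS b, Finset.sum_div]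
  congr 1
  refine Finset.sum_congr rfl fun k _ => ?_
  have := (integral_componentDensity_pos m hα hα_sum hS hb k).ne'
  unfold componentWeight
  field_simp

/-- One factor `min α` comes from the upper bound on the denominator, the other from `α k` in the
numerator. -/
theorem mul_iInf_sq_le_componentWeight (hα : ∀ k, 0 < α k) (hα_sum : ∑ k, α k = 1)
    (hS : ∀ k, (S k).PosDef) (hb : 0 < b) (hb1 : b ≤ 1) (k : Fin M) :
    ((∫ x, gaussianDensity (m k) (S k) x ^ b) /
        ∑ j, α j * ∫ x, gaussianDensity (m j) (S j) x ^ b) * (⨅ k, α k ^ 2) ≤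
      componentWeight α m S b k := by
  have := nonempty_of_sum_eq_one hα_sum
  have ha := iInf_pos_of_pos hα
  have hI : ∀ j, 0 < ∫ x, gaussianDensity (m j) (S j) x ^ b := fun j => by
    rw [integral_gaussianDensity_rpow _ (hS j) hb]
    exact gaussianPowIntegral_pos (hS j) hb
  have hle : ∀ j, ∫ x, componentDensity α m S b j x ≤
      1 / (⨅ k, α k) * ∫ x, gaussianDensity (m j) (S j) x ^ b := fun j => by
    rw [← integral_const_mul]
    exact integral_mono (integrable_componentDensity m hα hα_sum hS hb j)
      ((integrable_gaussianDensity_rpow (m j) (hS j) hb).const_mul _)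
      (componentDensity_le m hα hα_sum hS hb j)
  have hge : ∫ x, gaussianDensity (m k) (S k) x ^ b ≤ ∫ x, componentDensity α m S b k x :=
    integral_mono (integrable_gaussianDensity_rpow (m k) (hS k) hb)
      (integrable_componentDensity m hα hα_sum hS hb k)
      (le_componentDensity m hα hα_sum hS hb hb1 k)
  have hD : 0 < ∑ j, α j * ∫ x, gaussianDensity (m j) (S j) x ^ b :=
    Finset.sum_pos (fun j _ => mul_pos (hα j) (hI j)) Finset.univ_nonempty
  have hsum : ∑ j, α j * ∫ x, componentDensity α m S b j x ≤
      1 / (⨅ k, α k) * ∑ j, α j * ∫ x, gaussianDensity (m j) (S j) x ^ b := by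
    rw [Finset.mul_sum]
    refine Finset.sum_le_sum fun j _ => ?_
    rw [mul_left_comm]
    exact mul_le_mul_of_nonneg_left (hle j) (hα j).le
  have hsq : ⨅ k, α k ^ 2 ≤ (⨅ k, α k) * α k := by
    obtain ⟨k₀, hk₀⟩ := exists_eq_ciInf_of_finite (f := α)
    refine (iInf_le_of_finite (fun k => α k ^ 2) k₀).trans ?_
    simp only [sq, hk₀]
    exact mul_le_mul_of_nonneg_left (iInf_le_of_finite α k) ha.le
  calc _ ≤ ((∫ x, gaussianDensity (m k) (S k) x ^ b) /
        ∑ j, α j * ∫ x, gaussianDensity (m j) (S j) x ^ b) * ((⨅ k, α k) * α k) :=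
        mul_le_mul_of_nonneg_left hsq (div_pos (hI k) hD).le
    _ = (α k * ∫ x, gaussianDensity (m k) (S k) x ^ b) /
        (1 / (⨅ k, α k) * ∑ j, α j * ∫ x, gaussianDensity (m j) (S j) x ^ b) := by
        field_simp
    _ ≤ _ := div_le_div₀ (mul_pos (hα k) (integral_componentDensity_pos m hα hα_sum hS hb k)).le
        (mul_le_mul_of_nonneg_left hge (hα k).le)
        (sum_mul_integral_componentDensity_pos m hα hα_sum hS hb) hsum

theorem iInf_sq_le_componentWeight (hα : ∀ k, 0 < α k) (hα_sum : ∑ k, α k = 1)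
    (hS : ∀ k, (S k).PosDef) (hS_eq : ∀ j k, S j = S k) (hb : 0 < b) (hb1 : b ≤ 1) (k : Fin M) :
    ⨅ k, α k ^ 2 ≤ componentWeight α m S b k := by
  have h := mul_iInf_sq_le_componentWeight m hα hα_sum hS hb hb1 k
  -- The integral of `q ^ b` depends on the covariance but not on the mean, so with equal
  -- covariances the quotient is `1`.
  have hI : ∀ j, ∫ x, gaussianDensity (m j) (S j) x ^ b = gaussianPowIntegral (S k) b := fun j => by
    rw [integral_gaussianDensity_rpow _ (hS j) hb, hS_eq j k]
  simp_rw [hI] at h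
  rwa [← Finset.sum_mul, hα_sum, one_mul, div_self (gaussianPowIntegral_pos (hS k) hb).ne',
    one_mul] at h

end Mixture

end TemperedMixture

theorem mainTheorem6 {d M n : ℕ} (α : Fin M → ℝ) (m : Fin M → EuclideanSpace ℝ (Fin d))
    (S : Fin M → Matrix (Fin d) (Fin d) ℝ) (β : Fin (n + 1) → ℝ)
    (hα : ∀ k, 0 < α k) (hα_sum : ∑ k, α k = 1) (hS : ∀ k, (S k).PosDef)
    (hβ_pos : 0 < β 0) (hβ_mono : StrictMono β) (hβ_last : β (Fin.last n) = 1) :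
    -- the tempered measures and their components are well-defined probability measures
    (∀ i, IsProbabilityMeasure (temperedMeasure α m S (β i))) ∧
    (∀ i k, IsProbabilityMeasure (componentMeasure α m S (β i) k)) ∧
    -- density ratio bound between consecutive levels
    (∀ i : Fin n,
      temperedMeasure α m S (β i.succ) ≪ temperedMeasure α m S (β i.castSucc) ∧
      ∀ᵐ x ∂(temperedMeasure α m S (β i.castSucc)),
        (temperedMeasure α m S (β i.succ)).rnDeriv (temperedMeasure α m S (β i.castSucc)) x ≤
          ENNReal.ofReal (1 / (⨅ k, α k) * (β i.succ / β i.castSucc) ^ ((d : ℝ) / 2) *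
            ((⨆ k, (S k).det) / (⨅ k, (S k).det)) ^ ((β i.succ - β i.castSucc) / 2))) ∧
    -- mixture decomposition at every level
    (∀ i, (∀ k, 0 < componentWeight α m S (β i) k) ∧
      ∑ k, componentWeight α m S (β i) k = 1 ∧
      temperedMeasure α m S (β i) =
        ∑ k, ENNReal.ofReal (componentWeight α m S (β i) k) •
          componentMeasure α m S (β i) k) ∧
    -- log-Sobolev inequality and log-Sobolev constant of every component
    (∀ i k,
      SatisfiesLSI (componentMeasure α m S (β i) k)
        (Real.toNNReal (1 / (⨅ j, α j) * ((⨆ l, (hS k).isHermitian.eigenvalues l) / β i))) ∧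
      logSobolevConstant (componentMeasure α m S (β i) k) ≤
        ENNReal.ofReal (1 / (⨅ j, α j) * ((⨆ l, (hS k).isHermitian.eigenvalues l) / β i))) ∧
    -- lower bound on the weights
    (⨅ i, ⨅ k, (∫ x, gaussianDensity (m k) (S k) x ^ β i) /
        ∑ j, α j * ∫ x, gaussianDensity (m j) (S j) x ^ β i) * (⨅ k, α k ^ 2) ≤
      ⨅ i, ⨅ k, componentWeight α m S (β i) k ∧
    ((∀ j k, S j = S k) →
      (⨅ k, α k ^ 2) ≤ ⨅ i, ⨅ k, componentWeight α m S (β i) k) := by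
  have hM := nonempty_of_sum_eq_one hα_sum
  have hβ : ∀ i, 0 < β i := fun i => hβ_pos.trans_le (hβ_mono.monotone (Fin.zero_le i))
  have hβ1 : ∀ i, β i ≤ 1 := fun i => hβ_last ▸ hβ_mono.monotone (Fin.le_last i)
  refine ⟨fun i => isProbabilityMeasure_temperedMeasure m hα hα_sum hS (hβ i),
    fun i k => isProbabilityMeasure_componentMeasure m hα hα_sum hS (hβ i) k, fun i => ?_,
    fun i => ⟨componentWeight_pos m hα hα_sum hS (hβ i), sum_componentWeight m hα hα_sum hS (hβ i),
      temperedMeasure_eq_sum m hα hα_sum hS (hβ i)⟩,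
    fun i k => ?_, ?_, fun hS_eq => ?_⟩
  · have hle : β i.castSucc ≤ β i.succ := (hβ_mono i.castSucc_lt_succ).le
    have := isProbabilityMeasure_temperedMeasure m hα hα_sum hS (hβ i.castSucc)
    -- An explicit density gives absolute continuity, agrees almost everywhere with the
    -- Radon–Nikodym derivative, and satisfies the bound pointwise.
    rw [temperedMeasure_eq_withDensity_temperedMeasure m hα hα_sum hS (hβ i.castSucc) (hβ i.succ)]
    refine ⟨withDensity_absolutelyContinuous _ _, ?_⟩
    filter_upwards [Measure.rnDeriv_withDensity (temperedMeasure α m S (β i.castSucc))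
      ((continuous_mixtureDensity_rpow m hα hα_sum hS _).mul_const _).measurable.ennreal_ofReal]
      with x hx
    rw [hx]
    exact ENNReal.ofReal_le_ofReal
      (mixtureDensity_rpow_sub_mul_le m hα hα_sum hS (hβ _) hle (hβ1 _) x)
  · have h := satisfiesLSI_componentMeasure m hα hα_sum hS (hβ i) (hβ1 i) k
    exact ⟨h, logSobolevConstant_le h⟩
  · refine le_ciInf fun i => le_ciInf fun k => ?_
    refine (mul_le_mul_of_nonneg_right ?_ (Real.iInf_nonneg fun k => sq_nonneg (α k))).trans
      (mul_iInf_sq_le_componentWeight m hα hα_sum hS (hβ i) (hβ1 i) k)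
    exact (iInf_le_of_finite _ i).trans (iInf_le_of_finite _ k)
  · exact le_ciInf fun i => le_ciInf fun k =>
      iInf_sq_le_componentWeight m hα hα_sum hS hS_eq (hβ i) (hβ1 i) k
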